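/- Let $Z$ be a measurable space and $T:Z\to Z$ a measurable map which has at least one invariant probability measure. Let $l:Z\to\mathbb R$ be measurable with $c\le l\le C$ for some constants $0<c\le C<\infty$. The suspension is $\overline Z=(Z\times[0,\infty))/\sim$, where $\sim$ is the equivalence relation generated by $(x,l(x)+s)\sim(Tx,s)$, $s\ge 0$, with the quotient of the product $\sigma$-algebra, and the suspension (semi)flow is $\varphi_t(x,s)=(x,s+t)$, $t\ge 0$. Let $f:\overline Z\to\mathbb R$ be measurable, bounded and nonnegative, and put $f_Z(x)=\int_0^{l(x)}f(x,s)\,ds$ for $x\in Z$. Write $h_\mu\in[0,\infty]$ for the measure-theoretic (Kolmogorov–Sinai) entropy of a $T$-invariant probability measure $\mu$, and $h_m\in[0,\infty]$ for the entropy of a $\varphi$-invariant probability measure $m$ with respect to the time-one map $\varphi_1$. For bounded measurable $g$ on $Z$ let $\mathcal P_Z(g)=\sup_\mu\{h_\mu+\int g\,d\mu\}$, the supremum being over all $T$-invariant probability measures, and let $\mathcal P_{\overline Z}(f,\varphi)=\sup_m\{h_m+\int f\,dm\}$, the supremum being over all $\varphi$-invariant probability measures on $\overline Z$; both are elements of $(-\infty,\infty]$.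 A measure which is invariant and attains the respective supremum is called an equilibrium measure for $g$, respectively for $f$. For a probability measure $\mu$ on $Z$ let $\frac{\mu\times dt}{\int l\,d\mu}$ be the probability measure on $\overline Z$ obtained from the restriction of $\mu\times dt$ to $\{(x,s):0\le s<l(x)\}$ by normalization. Then the following hold. 1. For every real number $t$, $\mathcal P_{\overline Z}(f,\varphi)=t$ if and only if $\mathcal P_Z(f_Z-t\,l)=0$. Moreover, if the entropies $h_\mu$ of the $T$-invariant probability measures are bounded above by a finite constant, then there is exactly one real number $t_0$ with $\mathcal P_Z(f_Z-t_0\,l)=0$ (so that $\mathcal P_{\overline Z}(f,\varphi)=t_0$). 2. Let $t_0$ be a real number with $\mathcal P_Z(f_Z-t_0\,l)=0$. Then a probability measure $\mu$ on $Z$ is an equilibrium measure for $f_Z-t_0\,l$ if and only if $\frac{\mu\times dt}{\int l\,d\mu}$ is an equilibrium measure for $f$. -/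

import Mathlib

open MeasureTheory Filter
open scoped NNReal ENNReal

namespace SuspensionPressure

/-! ### Measure-theoretic entropy

A finite measurable partition with at most `k` atoms is encoded by a measurable labelling
`P : X → Fin k`, whose fibres are the atoms (empty atoms contribute `0` to entropies). -/

/-- The Shannon entropy (natural logarithm) of the join `P ∨ T⁻¹P ∨ ⋯ ∨ T⁻⁽ⁿ⁻¹⁾P`. The atoms of
the join are indexed by the words `w` of length `n`. -/
noncomputable def joinEntropy {X : Type*} [MeasurableSpace X] (T : X → X) (μ : Measure X)
    {k : ℕ} (P : X → Fin k) (n : ℕ) : ℝ :=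
  ∑ w : Fin n → Fin k, Real.negMulLog (μ.real {x | ∀ i : Fin n, P (T^[i] x) = w i})

/-- The entropy `lim (1/n) H(P ∨ ⋯ ∨ T⁻⁽ⁿ⁻¹⁾P)` of `T` relative to the partition `P`. (For
invariant `μ` the limit exists by subadditivity, so that `limsup` is the limit.) -/
noncomputable def partitionEntropy {X : Type*} [MeasurableSpace X] (T : X → X) (μ : Measure X)
    {k : ℕ} (P : X → Fin k) : EReal :=
  limsup (fun n : ℕ => ((joinEntropy T μ P n / n : ℝ) : EReal)) atTop

/-- The measure-theoretic (Kolmogorov–Sinai) entropy `h_μ` of `T`, possibly `⊤`: the supremum of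
the relative entropies over all finite measurable partitions. -/
noncomputable def entropy {X : Type*} [MeasurableSpace X] (T : X → X) (μ : Measure X) : EReal :=
  ⨆ (k : ℕ) (P : X → Fin k) (_ : Measurable P), partitionEntropy T μ P

/-! ### Pressure and equilibrium measures of a transformation -/

/-- `μ` is a `T`-invariant probability measure. -/
def IsInvariantProb {X : Type*} [MeasurableSpace X] (T : X → X) (μ : Measure X) : Prop :=
  IsProbabilityMeasure μ ∧ MeasurePreserving T μ μ

/-- The pressure `sup {h_μ + ∫ g dμ}` over the `T`-invariant probability measures `μ`. -/
noncomputable def pressure {X : Type*} [MeasurableSpace X] (T : X → X) (g : X → ℝ) : EReal :=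
  ⨆ (μ : Measure X) (_ : IsInvariantProb T μ), entropy T μ + ((∫ x, g x ∂μ : ℝ) : EReal)

/-- `μ` is a `T`-invariant probability measure realizing the maximum of `h_μ + ∫ g dμ`. -/
def IsEquilibrium {X : Type*} [MeasurableSpace X] (T : X → X) (g : X → ℝ) (μ : Measure X) :
    Prop :=
  IsInvariantProb T μ ∧ ∀ ν : Measure X, IsInvariantProb T ν →
    entropy T ν + ((∫ x, g x ∂ν : ℝ) : EReal) ≤ entropy T μ + ((∫ x, g x ∂μ : ℝ) : EReal)

/-! ### Pressure and equilibrium measures of a (semi)flow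

The entropy of an invariant measure is its entropy for the time-one map. -/

/-- `m` is a probability measure that is invariant under all `φ t`, `t ≥ 0`. (If the `φ t` are
the maps of a measurable flow, this is invariance under the whole flow, since `φ (-t)` is the
inverse of `φ t`.) -/
def IsFlowInvariantProb {X : Type*} [MeasurableSpace X] (φ : ℝ≥0 → X → X) (m : Measure X) :
    Prop :=
  IsProbabilityMeasure m ∧ ∀ t : ℝ≥0, MeasurePreserving (φ t) m m

/-- The pressure `sup {h_m + ∫ g dm}` over the `φ`-invariant probability measures `m`. -/
noncomputable def flowPressure {X : Type*} [MeasurableSpace X] (φ : ℝ≥0 → X → X) (g : X → ℝ) :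
    EReal :=
  ⨆ (m : Measure X) (_ : IsFlowInvariantProb φ m),
    entropy (φ 1) m + ((∫ x, g x ∂m : ℝ) : EReal)

/-- `m` is a `φ`-invariant probability measure realizing the maximum of `h_m + ∫ g dm`. -/
def IsFlowEquilibrium {X : Type*} [MeasurableSpace X] (φ : ℝ≥0 → X → X) (g : X → ℝ)
    (m : Measure X) : Prop :=
  IsFlowInvariantProb φ m ∧ ∀ n : Measure X, IsFlowInvariantProb φ n →
    entropy (φ 1) n + ((∫ x, g x ∂n : ℝ) : EReal) ≤
      entropy (φ 1) m + ((∫ x, g x ∂m : ℝ) : EReal)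

/-! ### The suspension -/

/-- The gluing `(x, l x + s) ∼ (T x, s)`, `s ≥ 0`; for `s = 0` it identifies `(x, l x)` with
`(T x, 0)`, and it is the least such identification that the translations respect. -/
def SuspensionRel {Z : Type*} (T : Z → Z) (l : Z → ℝ) (p q : Z × ℝ≥0) : Prop :=
  (p.2 : ℝ) = l p.1 + q.2 ∧ q.1 = T p.1

/-- The suspension space `Z × [0, ∞) / ∼` (quotient by the equivalence relation generated by the
gluing). -/
def Suspension {Z : Type*} (T : Z → Z) (l : Z → ℝ) : Type _ :=
  Quot (SuspensionRel T l)

namespace Suspension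

/-- The class of `(x, s)`, for `s ≥ 0`. -/
def mk {Z : Type*} (T : Z → Z) (l : Z → ℝ) (x : Z) (s : ℝ≥0) : Suspension T l :=
  Quot.mk _ (x, s)

/-- The quotient σ-algebra of the product σ-algebra: a set is measurable iff its preimage in
`Z × [0, ∞)` is. -/
instance {Z : Type*} [MeasurableSpace Z] (T : Z → Z) (l : Z → ℝ) :
    MeasurableSpace (Suspension T l) :=
  inferInstanceAs (MeasurableSpace (Quot (SuspensionRel T l)))

/-- The suspension (semi)flow `φ_t (x, s) = (x, s + t)`, `t ≥ 0`. -/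
def flow {Z : Type*} (T : Z → Z) (l : Z → ℝ) (t : ℝ≥0) : Suspension T l → Suspension T l :=
  Quot.map (fun p => (p.1, p.2 + t)) (by
    rintro ⟨x, s⟩ ⟨y, u⟩ ⟨h1, h2⟩
    refine ⟨?_, h2⟩
    simp only [NNReal.coe_add] at h1 ⊢
    rw [h1, add_assoc])

/-- The function `f_Z x = ∫_0^{l x} f (x, s) ds` on the base. -/
noncomputable def baseFunction {Z : Type*} (T : Z → Z) (l : Z → ℝ) (f : Suspension T l → ℝ)
    (x : Z) : ℝ :=
  ∫ s in (0 : ℝ)..l x, f (mk T l x s.toNNReal)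

/-- The measure `(μ × dt) / ∫ l dμ` on the suspension: the product of `μ` with Lebesgue measure,
restricted to the region `{(x, s) | 0 ≤ s < l x}` (which contains one representative of each
class), normalized and carried to the quotient. -/
noncomputable def liftMeasure {Z : Type*} [MeasurableSpace Z] (T : Z → Z) (l : Z → ℝ)
    (μ : Measure Z) : Measure (Suspension T l) :=
  (ENNReal.ofReal (∫ x, l x ∂μ))⁻¹ •
    ((μ.prod (volume : Measure ℝ)).restrict {p | 0 ≤ p.2 ∧ p.2 < l p.1}).map
      (fun p => mk T l p.1 p.2.toNNReal)

end Suspension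

end SuspensionPressure

namespace SuspensionPressure

set_option linter.unusedSectionVars false

/-! ### Shannon entropy of finite labellings -/

/-! ### Inequalities for finite sums of `negMulLog` -/

section RealInequalities

open Real Finset

/-! The theorem rests on two facts. Every flow-invariant probability measure is the lift of a
`T`-invariant `μ` (`exists_eq_liftMeasure`), and Abramov's formula says that its entropy is `h_μ / ∫
l dμ` (`entropy_flow_le_iff`). Since `∫ f dm = ∫ f_Z dμ / ∫ l dμ` for the lift `m`, one gets `(h_m +
∫ f dm - t) ∫ l dμ = h_μ + ∫ (f_Z - t l) dμ`. As `∫ l dμ` lies between the positive constants `c`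
and `C`, the two free energies have suprema `t` and `0` simultaneously and are maximized by
corresponding measures. Bounded entropy makes the flow pressure finite, hence gives exactly one
`t₀`.

Abramov's formula is proved with finite partitions only and without ergodicity. For `δ ≤ c`, write
the height of a point as `s = (u + i) δ` with `u ∈ [0, 1)` and an integer level `i`. The time-`δ`
map raises `i` until the roof is crossed, and then returns to level `0` over the image of `(x, u)`
under `(x, u) ↦ (T x, u - l x / δ mod 1)`. It is therefore a tower with bounded integer heights over
a circle extension of `T` (`isTower_flow`).

A tower label tells nothing new once the future is known, except on passing from the top to the
base, so the entropy of a tower is that of its base times the normalizing factor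
(`IsTower.rate_label`). A circle extension adds at most `log 2` to the entropy, the cost of one
carry bit per step; its `n`-th iterate is again a circle extension, so the excess is at most `log 2
/ n` for all `n`, hence zero (`entropy_circleExt_le_iff`).

For the lifting of measures, invariance under all times forces the measure to be Lebesgue along the
fibres (`measure_eq_lintegral_base`). Invariance of the base measure is then read off from a collar
of width `c`. -/

theorem negMulLog_sum_le {β : Type*} (s : Finset β) (p : β → ℝ) (hp : ∀ b ∈ s, 0 ≤ p b) :
    negMulLog (∑ b ∈ s, p b) ≤ ∑ b ∈ s, negMulLog (p b) := by
  simp only [negMulLog]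
  rw [← neg_mul_eq_neg_mul, Finset.sum_mul, ← Finset.sum_neg_distrib]
  refine Finset.sum_le_sum fun b hb => ?_
  rcases (hp b hb).eq_or_lt with h | h
  · simp [← h]
  · have h1 : p b ≤ ∑ b ∈ s, p b := Finset.single_le_sum hp hb
    have := mul_le_mul_of_nonneg_left (Real.log_le_log h h1) h.le
    linarith

/-- This is `log x ≤ x - 1` at `x = q / p`, times `p`. Summed over two families of equal total mass
it is Gibbs' inequality; `h` is absolute continuity. -/
theorem sub_le_mul_log_div {p q : ℝ} (hp : 0 ≤ p) (hq : 0 ≤ q) (h : q = 0 → p = 0) :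
    p - q ≤ p * (Real.log p - Real.log q) := by
  rcases hp.eq_or_lt with rfl | hp
  · simpa using hq
  · have hq : 0 < q := lt_of_le_of_ne hq fun h' => hp.ne' (h h'.symm)
    have h1 := Real.log_le_sub_one_of_pos (div_pos hq hp)
    rw [Real.log_div hq.ne' hp.ne'] at h1
    have h2 := mul_le_mul_of_nonneg_left h1 hp.le
    have h3 : p * (q / p - 1) = q - p := by field_simp
    linarith

/-- Conditional mutual information is nonnegative: compare `p` with `u a c * v b c / w c`, which
makes `a` and `b` independent given `c` and has the same total mass. No normalization of `p` is
needed. -/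
theorem sum_negMulLog_submodular {α β γ : Type*} [Fintype α] [Fintype β] [Fintype γ]
    (p : α → β → γ → ℝ) (hp : ∀ a b c, 0 ≤ p a b c) :
    (∑ a, ∑ b, ∑ c, negMulLog (p a b c)) + ∑ c, negMulLog (∑ a, ∑ b, p a b c) ≤
      (∑ a, ∑ c, negMulLog (∑ b, p a b c)) + ∑ b, ∑ c, negMulLog (∑ a, p a b c) := by
  set u : α → γ → ℝ := fun a c => ∑ b, p a b c with hu
  set v : β → γ → ℝ := fun b c => ∑ a, p a b c with hv
  set w : γ → ℝ := fun c => ∑ a, ∑ b, p a b c with hw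
  have u0 : ∀ a c, 0 ≤ u a c := fun a c => sum_nonneg fun b _ => hp a b c
  have v0 : ∀ b c, 0 ≤ v b c := fun b c => sum_nonneg fun a _ => hp a b c
  have wu : ∀ c, w c = ∑ a, u a c := fun c => rfl
  have wv : ∀ c, w c = ∑ b, v b c := fun c => sum_comm
  have w0 : ∀ c, 0 ≤ w c := fun c => by rw [wu]; exact sum_nonneg fun a _ => u0 a c
  have pu : ∀ a b c, p a b c ≤ u a c := fun a b c =>
    single_le_sum (f := fun b => p a b c) (fun b _ => hp a b c) (mem_univ b)
  have pv : ∀ a b c, p a b c ≤ v b c := fun a b c =>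
    single_le_sum (f := fun a => p a b c) (fun a _ => hp a b c) (mem_univ a)
  have uw : ∀ a c, u a c ≤ w c := fun a c => by
    rw [wu]; exact single_le_sum (f := fun a => u a c) (fun a _ => u0 a c) (mem_univ a)
  have key : ∀ a b c, p a b c - u a c * v b c / w c ≤
      p a b c * (Real.log (p a b c) + Real.log (w c) - Real.log (u a c) - Real.log (v b c)) := by
    intro a b c
    rcases (hp a b c).eq_or_lt with h | h
    · rw [← h]
      simp only [zero_mul, zero_sub, neg_nonpos]
      exact div_nonneg (mul_nonneg (u0 a c) (v0 b c)) (w0 c)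
    · have hu' := h.trans_le (pu a b c)
      have hv' := h.trans_le (pv a b c)
      have hw' := hu'.trans_le (uw a c)
      have := sub_le_mul_log_div (hp a b c) (q := u a c * v b c / w c) (by positivity)
        (fun h' => absurd h' (by positivity))
      rw [Real.log_div (by positivity) hw'.ne', Real.log_mul hu'.ne' hv'.ne'] at this
      calc _ ≤ _ := this
        _ = _ := by ring
  have hsum : ∑ a, ∑ b, ∑ c, (p a b c - u a c * v b c / w c) = 0 := by
    simp only [sum_sub_distrib]
    have e1 : ∑ a, ∑ b, ∑ c, u a c * v b c / w c = ∑ c, w c := by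
      rw [sum_congr rfl fun a _ => sum_comm, sum_comm]
      refine sum_congr rfl fun c _ => ?_
      simp only [← sum_div, ← mul_sum, ← sum_mul]
      rw [← wv, ← wu]
      rcases eq_or_ne (w c) 0 with h | h
      · simp [h]
      · field_simp
    have e2 : ∑ a, ∑ b, ∑ c, p a b c = ∑ c, w c := by
      rw [sum_congr rfl fun a _ => sum_comm, sum_comm]
    rw [e1, e2, sub_self]
  have hle := sum_le_sum fun a (_ : a ∈ univ) => sum_le_sum fun b (_ : b ∈ univ) =>
    sum_le_sum fun c (_ : c ∈ univ) => key a b c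
  rw [hsum] at hle
  have f1 : ∑ c, negMulLog (w c) = - ∑ a, ∑ b, ∑ c, p a b c * Real.log (w c) := by
    rw [sum_congr rfl fun a _ => sum_comm, sum_comm, ← sum_neg_distrib]
    refine sum_congr rfl fun c _ => ?_
    simp only [negMulLog, ← sum_mul]
    rw [neg_mul]
  have f2 : ∑ a, ∑ c, negMulLog (u a c) = - ∑ a, ∑ b, ∑ c, p a b c * Real.log (u a c) := by
    rw [← sum_neg_distrib]
    refine sum_congr rfl fun a _ => ?_
    rw [sum_comm, ← sum_neg_distrib]
    refine sum_congr rfl fun c _ => ?_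
    simp only [negMulLog, ← sum_mul]
    rw [neg_mul]
  have f3 : ∑ b, ∑ c, negMulLog (v b c) = - ∑ a, ∑ b, ∑ c, p a b c * Real.log (v b c) := by
    rw [sum_comm (s := (univ : Finset α)), ← sum_neg_distrib]
    refine sum_congr rfl fun b _ => ?_
    rw [sum_comm, ← sum_neg_distrib]
    refine sum_congr rfl fun c _ => ?_
    simp only [negMulLog, ← sum_mul]
    rw [neg_mul]
  have f4 : ∑ a, ∑ b, ∑ c, negMulLog (p a b c) =
      - ∑ a, ∑ b, ∑ c, p a b c * Real.log (p a b c) := by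
    simp only [negMulLog, ← sum_neg_distrib, neg_mul]
  rw [f1, f2, f3, f4]
  have h5 : ∑ a, ∑ b, ∑ c, p a b c *
      (Real.log (p a b c) + Real.log (w c) - Real.log (u a c) - Real.log (v b c)) =
      ∑ a, ∑ b, ∑ c, p a b c * Real.log (p a b c) + ∑ a, ∑ b, ∑ c, p a b c * Real.log (w c)
      - ∑ a, ∑ b, ∑ c, p a b c * Real.log (u a c)
      - ∑ a, ∑ b, ∑ c, p a b c * Real.log (v b c) := by
    simp only [← sum_add_distrib, ← sum_sub_distrib]
    refine sum_congr rfl fun a _ => sum_congr rfl fun b _ => sum_congr rfl fun c _ => ?_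
    ring
  rw [h5] at hle
  linarith

/-- Gibbs' inequality against the uniform distribution. -/
theorem sum_negMulLog_le_log_card {α : Type*} [Fintype α] (p : α → ℝ) (hp : ∀ a, 0 ≤ p a)
    (h1 : ∑ a, p a = 1) : ∑ a, negMulLog (p a) ≤ Real.log (Fintype.card α) := by
  have hne : Nonempty α := by
    by_contra h
    rw [not_nonempty_iff] at h
    simp at h1
  have hc : (0 : ℝ) < Fintype.card α := by exact_mod_cast Fintype.card_pos
  have := sum_le_sum fun a (_ : a ∈ univ) =>
    sub_le_mul_log_div (hp a) (q := (Fintype.card α : ℝ)⁻¹) (by positivity)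
      (fun h' => absurd h' (by positivity))
  rw [sum_sub_distrib, h1] at this
  simp only [sum_const, card_univ, nsmul_eq_mul, mul_inv_cancel₀ hc.ne', sub_self, mul_sub,
    sum_sub_distrib, ← sum_mul, h1, Real.log_inv] at this
  simp only [negMulLog, neg_mul, sum_neg_distrib]
  linarith

end RealInequalities

variable {X Y : Type*} [MeasurableSpace X] [MeasurableSpace Y]

/-- The Shannon entropy of the partition into the fibres of a finite-valued map. -/
noncomputable def shannon {α : Type*} [Fintype α] (μ : Measure X) (A : X → α) : ℝ :=
  ∑ a, Real.negMulLog (μ.real (A ⁻¹' {a}))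

section Shannon

variable {α β γ : Type*} [Fintype α] [MeasurableSpace α] [MeasurableSingletonClass α]
  [Fintype β] [MeasurableSpace β] [MeasurableSingletonClass β]
  [Fintype γ] [MeasurableSpace γ] [MeasurableSingletonClass γ]
  {μ : Measure X} [IsProbabilityMeasure μ]

theorem sum_real_fiber_mul {A : X → α} (hA : Measurable A) (g : α → ℝ) :
    ∑ a, μ.real (A ⁻¹' {a}) * g a = ∫ x, g (A x) ∂μ := by
  have : IsProbabilityMeasure (μ.map A) := Measure.isProbabilityMeasure_map hA.aemeasurable
  rw [← integral_map (f := g) hA.aemeasurable (measurable_of_finite g).aestronglyMeasurable,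
    integral_fintype Integrable.of_finite]
  refine Finset.sum_congr rfl fun a _ => ?_
  rw [map_measureReal_apply hA (measurableSet_singleton a), smul_eq_mul]

/-- The information function involves `A` only through the relation `A y = A x`, so relabelling
becomes invisible. -/
theorem shannon_eq_integral {A : X → α} (hA : Measurable A) :
    shannon μ A = ∫ x, -Real.log (μ.real {y | A y = A x}) ∂μ := by
  have := sum_real_fiber_mul (μ := μ) hA (fun a => -Real.log (μ.real (A ⁻¹' {a})))
  rw [show (fun x => -Real.log (μ.real {y | A y = A x})) =
    fun x => (fun a => -Real.log (μ.real (A ⁻¹' {a}))) (A x) from rfl, ← this]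
  refine Finset.sum_congr rfl fun a _ => ?_
  simp [Real.negMulLog]

/-- The entropy depends only on the partition, not on the labels. -/
theorem shannon_congr {A : X → α} {B : X → β} (hA : Measurable A) (hB : Measurable B)
    (h : ∀ x y, A x = A y ↔ B x = B y) : shannon μ A = shannon μ B := by
  rw [shannon_eq_integral hA, shannon_eq_integral hB]
  simp only [h]

theorem sum_real_inter_fiber {A : X → α} (hA : Measurable A) {s : Set X} :
    ∑ a, μ.real (s ∩ A ⁻¹' {a}) = μ.real s := by
  have := sum_measureReal_preimage_singleton (μ := μ.restrict s) Finset.univ (f := A)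
    (fun a _ => hA (measurableSet_singleton a))
  simp only [Finset.coe_univ, Set.preimage_univ] at this
  rw [measureReal_restrict_apply_univ] at this
  rw [← this]
  refine Finset.sum_congr rfl fun a _ => ?_
  rw [measureReal_restrict_apply (hA (measurableSet_singleton a)), Set.inter_comm]

theorem shannon_le_prod {A : X → α} {B : X → β} (hB : Measurable B) :
    shannon μ A ≤ shannon μ (fun x => (A x, B x)) := by
  simp only [shannon, Fintype.sum_prod_type]
  refine Finset.sum_le_sum fun a _ => ?_
  rw [← sum_real_inter_fiber hB]
  refine (negMulLog_sum_le _ _ fun _ _ => measureReal_nonneg).trans_eq ?_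
  refine Finset.sum_congr rfl fun b _ => ?_
  congr 2
  ext x
  simp

/-- A coarser partition has a smaller entropy. -/
theorem shannon_mono {A : X → α} {B : X → β} (hA : Measurable A) (hB : Measurable B)
    (h : ∀ x y, B x = B y → A x = A y) : shannon μ A ≤ shannon μ B := by
  refine (shannon_le_prod hB).trans_eq (shannon_congr (hA.prodMk hB) hB fun x y => ?_)
  rw [Prod.mk.injEq]
  exact ⟨fun h => h.2, fun h' => ⟨h x y h', h'⟩⟩

/-- Strong subadditivity of the entropy. -/
theorem shannon_submodular {A : X → α} {B : X → β} {C : X → γ} (hA : Measurable A)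
    (hB : Measurable B) :
    shannon μ (fun x => (A x, B x, C x)) + shannon μ C ≤
      shannon μ (fun x => (A x, C x)) + shannon μ (fun x => (B x, C x)) := by
  have := sum_negMulLog_submodular
    (fun a b c => μ.real ((fun x => (A x, B x, C x)) ⁻¹' {(a, b, c)}))
    (fun _ _ _ => measureReal_nonneg)
  have e1 : ∀ a c, ∑ b, μ.real ((fun x => (A x, B x, C x)) ⁻¹' {(a, b, c)}) =
      μ.real ((fun x => (A x, C x)) ⁻¹' {(a, c)}) := fun a c => by
    rw [← sum_real_inter_fiber hB]
    refine Finset.sum_congr rfl fun b _ => ?_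
    congr 1
    ext x
    simp only [Set.mem_preimage, Set.mem_singleton_iff, Prod.mk.injEq, Set.mem_inter_iff]
    tauto
  have e2 : ∀ b c, ∑ a, μ.real ((fun x => (A x, B x, C x)) ⁻¹' {(a, b, c)}) =
      μ.real ((fun x => (B x, C x)) ⁻¹' {(b, c)}) := fun b c => by
    rw [← sum_real_inter_fiber hA]
    refine Finset.sum_congr rfl fun a _ => ?_
    congr 1
    ext x
    simp only [Set.mem_preimage, Set.mem_singleton_iff, Prod.mk.injEq, Set.mem_inter_iff]
    tauto
  have e3 : ∀ c, ∑ a, ∑ b, μ.real ((fun x => (A x, B x, C x)) ⁻¹' {(a, b, c)}) =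
      μ.real (C ⁻¹' {c}) := fun c => by
    rw [← sum_real_inter_fiber hA]
    refine Finset.sum_congr rfl fun a _ => ?_
    rw [e1]
    congr 1
    ext x
    simp only [Set.mem_preimage, Set.mem_singleton_iff, Prod.mk.injEq, Set.mem_inter_iff]
    tauto
  simp only [e3] at this
  simp only [e1, e2] at this
  simpa only [shannon, Fintype.sum_prod_type] using this

theorem shannon_le_log_card {A : X → α} (hA : Measurable A) :
    shannon μ A ≤ Real.log (Fintype.card α) := by
  refine sum_negMulLog_le_log_card _ (fun _ => measureReal_nonneg) ?_
  simpa using sum_real_inter_fiber (μ := μ) hA (s := Set.univ)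

theorem shannon_unit [Subsingleton γ] (C : X → γ) : shannon μ C = 0 := by
  obtain ⟨x⟩ := nonempty_of_isProbabilityMeasure μ
  let _ : Unique γ := uniqueOfSubsingleton (C x)
  have : C ⁻¹' {default} = Set.univ := by ext; simp [eq_iff_true_of_subsingleton]
  rw [shannon, Fintype.sum_subsingleton _ default, this]
  simp

/-- Strong subadditivity with a trivial third partition. -/
theorem shannon_prod_le {A : X → α} {B : X → β} (hA : Measurable A) (hB : Measurable B) :
    shannon μ (fun x => (A x, B x)) ≤ shannon μ A + shannon μ B := by
  have := shannon_submodular (μ := μ) (C := fun _ => ()) hA hB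
  rw [shannon_unit (fun _ => ()), add_zero,
    shannon_congr (A := fun x => (A x, B x, ())) (B := fun x => (A x, B x)) (by fun_prop)
      (by fun_prop) (by simp),
    shannon_congr (A := fun x => (A x, ())) (B := A) (by fun_prop) hA (by simp),
    shannon_congr (A := fun x => (B x, ())) (B := B) (by fun_prop) hB (by simp)] at this
  exact this

/-- The conditional entropy of `A` given `B`. -/
noncomputable def condShannon (μ : Measure X) (A : X → α) (B : X → β) : ℝ :=
  shannon μ (fun x => (A x, B x)) - shannon μ B

/-- For `C` coarser than `B`, the joins of `A, B, C` and of `B, C` in strong subadditivity collapse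
to those of `A, B` and to `B`. -/
theorem condShannon_anti {A : X → α} {B : X → β} {C : X → γ} (hA : Measurable A)
    (hB : Measurable B) (hC : Measurable C) (h : ∀ x y, B x = B y → C x = C y) :
    condShannon μ A B ≤ condShannon μ A C := by
  have := shannon_submodular (μ := μ) (C := C) hA hB
  rw [shannon_congr (A := fun x => (A x, B x, C x)) (B := fun x => (A x, B x)) (by fun_prop)
      (by fun_prop) (by simp only [Prod.mk.injEq]; intro x y; have := h x y; tauto),
    shannon_congr (A := fun x => (B x, C x)) (B := B) (by fun_prop)
      (by fun_prop) (by simp only [Prod.mk.injEq]; intro x y; have := h x y; tauto)] at this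
  unfold condShannon
  linarith

/-- Partitions `B n` that converge to `A` in measure determine `A` up to small entropy. -/
theorem tendsto_condShannon {A : X → α} {B : ℕ → X → α} (hA : Measurable A)
    (hB : ∀ n, Measurable (B n))
    (h : Tendsto (fun n => μ.real {x | A x ≠ B n x}) atTop (nhds 0)) :
    Tendsto (fun n => condShannon μ A (B n)) atTop (nhds 0) := by
  have hne : ∀ n, MeasurableSet {x | A x ≠ B n x} := fun n =>
    (measurableSet_eq_fun hA (hB n)).compl
  -- Sets that agree off the exceptional set differ in measure by at most its measure. Continuity of
  -- `negMulLog` then sends the entropies of `(A, B n)` and `B n` to those of `(A, A)` and `A`,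
  -- which are equal.
  have key : ∀ (s t : Set X) (n : ℕ), (∀ x, A x = B n x → (x ∈ s ↔ x ∈ t)) →
      |μ.real s - μ.real t| ≤ μ.real {x | A x ≠ B n x} := by
    intro s t n hst
    rw [abs_le]
    have h1 : s ⊆ t ∪ {x | A x ≠ B n x} := fun x hx => by
      by_cases hx' : A x = B n x
      · exact Or.inl ((hst x hx').1 hx)
      · exact Or.inr hx'
    have h2 : t ⊆ s ∪ {x | A x ≠ B n x} := fun x hx => by
      by_cases hx' : A x = B n x
      · exact Or.inl ((hst x hx').2 hx)
      · exact Or.inr hx'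
    have h3 := (measureReal_mono (μ := μ) h1).trans (measureReal_union_le _ _)
    have h4 := (measureReal_mono (μ := μ) h2).trans (measureReal_union_le _ _)
    constructor <;> linarith
  have lim : ∀ (s : ℕ → Set X) (t : Set X), (∀ n x, A x = B n x → (x ∈ s n ↔ x ∈ t)) →
      Tendsto (fun n => Real.negMulLog (μ.real (s n))) atTop
        (nhds (Real.negMulLog (μ.real t))) := by
    intro s t hst
    refine (Real.continuous_negMulLog.tendsto _).comp ?_
    rw [tendsto_iff_dist_tendsto_zero]
    refine squeeze_zero (fun _ => dist_nonneg) (fun n => ?_) h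
    rw [Real.dist_eq]
    exact key _ _ n (hst n)
  have l1 : Tendsto (fun n => shannon μ (fun x => (A x, B n x))) atTop
      (nhds (shannon μ (fun x => (A x, A x)))) := by
    refine tendsto_finsetSum _ fun c _ => lim _ _ fun n x hx => ?_
    simp [← hx]
  have l2 : Tendsto (fun n => shannon μ (B n)) atTop (nhds (shannon μ A)) := by
    refine tendsto_finsetSum _ fun c _ => lim _ _ fun n x hx => ?_
    simp [← hx]
  have := l1.sub l2
  rw [shannon_congr (A := fun x => (A x, A x)) (B := A) (by fun_prop) hA (by simp),
    sub_self] at this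
  exact this

end Shannon

/-! ### Entropy rates of invariant measures -/

section Rate

variable {X Y : Type*} [MeasurableSpace X] [MeasurableSpace Y]
  {α β γ δ : Type*} [Fintype α] [MeasurableSpace α] [MeasurableSingletonClass α]
  [Fintype β] [MeasurableSpace β] [MeasurableSingletonClass β]
  [Fintype γ] [MeasurableSpace γ] [MeasurableSingletonClass γ]
  [Fintype δ] [MeasurableSpace δ] [MeasurableSingletonClass δ]
  {μ : Measure X} [IsProbabilityMeasure μ] {T : X → X}
  {ν : Measure Y} [IsProbabilityMeasure ν] {S : Y → Y}

theorem shannon_comp {φ : X → Y} (hφ : MeasurePreserving φ μ ν) {A : Y → α} (hA : Measurable A) :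
    shannon μ (fun x => A (φ x)) = shannon ν A := by
  refine Finset.sum_congr rfl fun a _ => ?_
  rw [Measure.real, Measure.real,
    ← hφ.measure_preimage (hA (measurableSet_singleton a)).nullMeasurableSet]
  rfl

theorem condShannon_comp {φ : X → Y} (hφ : MeasurePreserving φ μ ν) {A : Y → α} {B : Y → β}
    (hA : Measurable A) (hB : Measurable B) :
    condShannon μ (fun x => A (φ x)) (fun x => B (φ x)) = condShannon ν A B := by
  unfold condShannon
  rw [shannon_comp hφ hB, ← shannon_comp hφ (hA.prodMk hB)]

theorem condShannon_nonneg {A : X → α} {B : X → β} (hA : Measurable A) (hB : Measurable B) :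
    0 ≤ condShannon μ A B :=
  sub_nonneg.2 <| shannon_mono hB (hA.prodMk hB) fun _ _ h => (Prod.ext_iff.1 h).2

/-- Chain rule: `H(A₁, A₂ | B) = H(A₁ | A₂, B) + H(A₂ | B)`; then forget part of each condition. -/
theorem condShannon_prod_le {A₁ : X → α} {A₂ : X → β} {B₁ : X → γ} {B₂ : X → δ}
    (hA₁ : Measurable A₁) (hA₂ : Measurable A₂) (hB₁ : Measurable B₁) (hB₂ : Measurable B₂) :
    condShannon μ (fun x => (A₁ x, A₂ x)) (fun x => (B₁ x, B₂ x)) ≤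
      condShannon μ A₁ B₁ + condShannon μ A₂ B₂ := by
  have h1 : condShannon μ A₁ (fun x => (A₂ x, B₁ x, B₂ x)) ≤ condShannon μ A₁ B₁ :=
    condShannon_anti hA₁ (by fun_prop) hB₁ (by simp only [Prod.mk.injEq]; tauto)
  have h2 : condShannon μ A₂ (fun x => (B₁ x, B₂ x)) ≤ condShannon μ A₂ B₂ :=
    condShannon_anti hA₂ (by fun_prop) hB₂ (by simp only [Prod.mk.injEq]; tauto)
  have h3 : shannon μ (fun x => ((A₁ x, A₂ x), B₁ x, B₂ x)) =
      shannon μ (fun x => (A₁ x, A₂ x, B₁ x, B₂ x)) :=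
    shannon_congr (by fun_prop) (by fun_prop) (by simp only [Prod.mk.injEq]; tauto)
  unfold condShannon at *
  linarith

/-- The name of length `n` of a point with respect to the labelling `P`. -/
def word {X α : Type*} (T : X → X) (P : X → α) (n : ℕ) (x : X) (i : Fin n) : α := P (T^[i] x)

theorem word_eq_iff {X α : Type*} {T : X → X} {P : X → α} {n : ℕ} {x y : X} :
    word T P n x = word T P n y ↔ ∀ i < n, P (T^[i] x) = P (T^[i] y) := by
  rw [funext_iff]
  exact ⟨fun h i hi => h ⟨i, hi⟩, fun h i => h i i.2⟩

theorem word_succ_eq_iff {X α : Type*} {T : X → X} {P : X → α} {n : ℕ} {x y : X} :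
    word T P (n + 1) x = word T P (n + 1) y ↔
      P x = P y ∧ word T P n (T x) = word T P n (T y) := by
  simp only [word_eq_iff, Nat.forall_lt_succ_left, Function.iterate_zero, id_eq,
    Function.iterate_succ_apply]

@[fun_prop]
theorem measurable_word {P : X → α} (hT : Measurable T) (hP : Measurable P) (n : ℕ) :
    Measurable (word T P n) :=
  measurable_pi_lambda _ fun i => hP.comp (hT.iterate i)

theorem joinEntropy_eq (T : X → X) (μ : Measure X) {k : ℕ} (P : X → Fin k) (n : ℕ) :
    joinEntropy T μ P n = shannon μ (word T P n) := by
  refine Finset.sum_congr rfl fun w _ => ?_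
  congr 2
  ext x
  simp [word, funext_iff]

/-- The entropy of `T` relative to the labelling `P`, as the infimum of the conditional entropies
of `P` given a finite piece of the future. -/
noncomputable def rate (T : X → X) (μ : Measure X) (P : X → α) : ℝ :=
  ⨅ n, condShannon μ P (fun x => word T P n (T x))

theorem antitone_condShannon_word {P : X → α} (hT : Measurable T) (hP : Measurable P) :
    Antitone fun n => condShannon μ P (fun x => word T P n (T x)) := by
  refine antitone_nat_of_succ_le fun n => condShannon_anti hP (by fun_prop) (by fun_prop) ?_
  simp only [word_eq_iff]
  exact fun x y h i hi => h i (by omega)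

theorem tendsto_condShannon_word {P : X → α} (hT : Measurable T) (hP : Measurable P) :
    Tendsto (fun n => condShannon μ P (fun x => word T P n (T x))) atTop
      (nhds (rate T μ P)) := by
  refine tendsto_atTop_ciInf (antitone_condShannon_word hT hP) ⟨0, ?_⟩
  rintro _ ⟨n, rfl⟩
  exact condShannon_nonneg hP (by fun_prop)

/-- Chain rule, with invariance of `μ` removing the shift from the last `n` letters. -/
theorem shannon_word_succ {P : X → α} (hT : MeasurePreserving T μ μ) (hP : Measurable P) (n : ℕ) :
    shannon μ (word T P (n + 1)) =
      condShannon μ P (fun x => word T P n (T x)) + shannon μ (word T P n) := by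
  have hT' := hT.measurable
  rw [condShannon, shannon_comp hT (A := word T P n) (by fun_prop), sub_add_cancel]
  refine shannon_congr (by fun_prop) (by fun_prop) fun x y => ?_
  rw [word_succ_eq_iff, Prod.mk.injEq]

theorem shannon_word_eq_sum {P : X → α} (hT : MeasurePreserving T μ μ) (hP : Measurable P)
    (n : ℕ) : shannon μ (word T P n) =
      ∑ i ∈ Finset.range n, condShannon μ P (fun x => word T P i (T x)) := by
  induction n with
  | zero => rw [shannon_unit, Finset.sum_range_zero]
  | succ n ih => rw [shannon_word_succ hT hP, Finset.sum_range_succ, ih, add_comm]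

/-- By the chain rule the quotient is a Cesàro mean of a convergent sequence of conditional
entropies. -/
theorem tendsto_shannon_word {P : X → α} (hT : MeasurePreserving T μ μ) (hP : Measurable P) :
    Tendsto (fun n : ℕ => shannon μ (word T P n) / n) atTop (nhds (rate T μ P)) := by
  refine (tendsto_condShannon_word hT.measurable hP).cesaro.congr fun n => ?_
  rw [shannon_word_eq_sum hT hP, div_eq_inv_mul]

theorem rate_nonneg {P : X → α} (hT : Measurable T) (hP : Measurable P) : 0 ≤ rate T μ P :=
  le_ciInf fun _ => condShannon_nonneg hP (by fun_prop)

theorem rate_mono {P : X → α} {Q : X → β} (hT : MeasurePreserving T μ μ) (hP : Measurable P)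
    (hQ : Measurable Q) (h : ∀ x y, Q x = Q y → P x = P y) : rate T μ P ≤ rate T μ Q := by
  have hT' := hT.measurable
  refine le_of_tendsto_of_tendsto' (tendsto_shannon_word hT hP) (tendsto_shannon_word hT hQ)
    fun n => ?_
  gcongr
  refine shannon_mono (by fun_prop) (by fun_prop) fun x y => ?_
  simp only [word_eq_iff]
  exact fun h' i hi => h _ _ (h' i hi)

/-- Each of the `n` letters is conditioned on the `Q`-letter at the same time, and invariance makes
the costs equal. -/
theorem condShannon_word_le {P : X → α} {Q : X → β} (hT : MeasurePreserving T μ μ)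
    (hP : Measurable P) (hQ : Measurable Q) (n : ℕ) :
    condShannon μ (word T P n) (word T Q n) ≤ n * condShannon μ P Q := by
  have hT' := hT.measurable
  induction n with
  | zero => simp [condShannon, shannon_unit]
  | succ n ih =>
    have h1 : condShannon μ (word T P (n + 1)) (word T Q (n + 1)) =
        condShannon μ (fun x => (P x, word T P n (T x))) (fun x => (Q x, word T Q n (T x))) := by
      unfold condShannon
      congr 1 <;> refine shannon_congr (by fun_prop) (by fun_prop) fun x y => ?_
      · simp only [Prod.mk.injEq, word_succ_eq_iff]
      · simp only [Prod.mk.injEq, word_succ_eq_iff]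
    have h2 := condShannon_prod_le (μ := μ) hP
      ((measurable_word hT' hP n).comp hT') hQ ((measurable_word hT' hQ n).comp hT')
    have h3 := condShannon_comp hT (measurable_word hT' hP n) (measurable_word hT' hQ n)
    rw [h1]
    refine h2.trans ?_
    push_cast
    simp only [Function.comp_def] at h3 ⊢
    rw [h3]
    linarith

/-- Continuity of the rate in the partition, which allows passing to approximating partitions. -/
theorem rate_le_add_condShannon {P : X → α} {Q : X → β} (hT : MeasurePreserving T μ μ)
    (hP : Measurable P) (hQ : Measurable Q) : rate T μ P ≤ rate T μ Q + condShannon μ P Q := by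
  have hT' := hT.measurable
  refine le_of_tendsto_of_tendsto (tendsto_shannon_word hT hP)
    ((tendsto_shannon_word hT hQ).add_const _) ?_
  filter_upwards [eventually_gt_atTop 0] with n hn
  have hn' : (0 : ℝ) < n := by exact_mod_cast hn
  rw [div_le_iff₀ hn', add_mul, div_mul_cancel₀ _ hn'.ne']
  have h1 := condShannon_word_le hT hP hQ n
  have h2 : shannon μ (word T P n) ≤ shannon μ (fun x => (word T P n x, word T Q n x)) :=
    shannon_le_prod (by fun_prop)
  unfold condShannon at *
  linarith

theorem rate_prod_le {P : X → α} {Q : X → β} (hT : MeasurePreserving T μ μ)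
    (hP : Measurable P) (hQ : Measurable Q) :
    rate T μ (fun x => (P x, Q x)) ≤ rate T μ P + Real.log (Fintype.card β) := by
  refine (rate_le_add_condShannon hT (hP.prodMk hQ) hP).trans ?_
  have h1 : shannon μ (fun x => ((P x, Q x), P x)) = shannon μ (fun x => (P x, Q x)) :=
    shannon_congr (by fun_prop) (by fun_prop) (by simp only [Prod.mk.injEq]; tauto)
  have h2 := shannon_prod_le (μ := μ) hP hQ
  have h3 := shannon_le_log_card (μ := μ) hQ
  unfold condShannon
  linarith

theorem rate_comp {φ : X → Y} (hφ : MeasurePreserving φ μ ν) (hST : ∀ x, φ (T x) = S (φ x))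
    (hS : Measurable S) {P : Y → α} (hP : Measurable P) :
    rate T μ (fun x => P (φ x)) = rate S ν P := by
  unfold rate
  congr 1
  ext n
  rw [← condShannon_comp hφ hP (B := fun y => word S P n (S y)) (by fun_prop)]
  congr 1
  ext x i
  simp only [word, ← hST]
  congr 1
  exact Function.Semiconj.iterate_right (f := φ) (fun x => hST x) i (T x)

/-- A `T^[n]`-name of length `m` in blocks of `n` letters is a `T`-name of length `n * m`; the two
rates are compared along this subsequence. -/
theorem rate_iterate {P : X → α} (hT : MeasurePreserving T μ μ) (hP : Measurable P) {n : ℕ}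
    (hn : 0 < n) : rate T^[n] μ (word T P n) = n * rate T μ P := by
  have hT' := hT.measurable
  have hTn := hT.iterate n
  have hn' : (n : ℝ) ≠ 0 := by exact_mod_cast hn.ne'
  have key : ∀ m, shannon μ (word T^[n] (word T P n) m) = shannon μ (word T P (n * m)) := by
    refine fun m => shannon_congr (measurable_word hTn.measurable (by fun_prop) m) (by fun_prop)
      fun x y => ?_
    simp only [word_eq_iff, ← Function.iterate_mul, ← Function.iterate_add_apply]
    constructor
    · intro h i hi
      have := h (i / n) (Nat.div_lt_of_lt_mul hi) (i % n) (Nat.mod_lt _ hn)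
      rwa [Nat.mod_add_div] at this
    · intro h i hi j hj
      refine h _ ?_
      calc j + n * i < n + n * i := by omega
        _ = n * (i + 1) := by ring
        _ ≤ n * m := Nat.mul_le_mul_left _ hi
  refine tendsto_nhds_unique (tendsto_shannon_word hTn (by fun_prop)) ?_
  have h1 := ((tendsto_shannon_word hT hP).comp
    (tendsto_id.const_mul_atTop' hn)).const_mul (n : ℝ)
  refine h1.congr fun m => ?_
  rw [key]
  simp only [Function.comp_apply, id_eq]
  push_cast
  rcases eq_or_ne (m : ℝ) 0 with h | h
  · simp [h]
  · field_simp

theorem partitionEntropy_eq {k : ℕ} {P : X → Fin k} (hT : MeasurePreserving T μ μ)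
    (hP : Measurable P) : partitionEntropy T μ P = (rate T μ P : EReal) := by
  unfold partitionEntropy
  simp only [joinEntropy_eq]
  exact ((continuous_coe_real_ereal.tendsto _).comp (tendsto_shannon_word hT hP)).limsup_eq

/-- Admits labels in any finite type (words, products, predicates), although `entropy` is defined
with labels in `Fin k`. -/
theorem rate_le_entropy {P : X → α} (hT : MeasurePreserving T μ μ) (hP : Measurable P) :
    (rate T μ P : EReal) ≤ entropy T μ := by
  let e := Fintype.equivFin α
  have he : Measurable fun x => e (P x) := (measurable_of_finite e).comp hP
  calc (rate T μ P : EReal) ≤ rate T μ (fun x => e (P x)) :=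
        EReal.coe_le_coe_iff.2 <| rate_mono hT hP he fun _ _ h => e.injective h
    _ = partitionEntropy T μ (fun x => e (P x)) := (partitionEntropy_eq hT he).symm
    _ ≤ entropy T μ := le_iSup₂_of_le _ _ (le_iSup_of_le he le_rfl)

theorem entropy_le_iff (hT : MeasurePreserving T μ μ) {b : EReal} :
    entropy T μ ≤ b ↔ ∀ (k : ℕ) (P : X → Fin k), Measurable P → (rate T μ P : EReal) ≤ b := by
  refine ⟨fun h k P hP => (rate_le_entropy hT hP).trans h, fun h => ?_⟩
  refine iSup₂_le fun k P => iSup_le fun hP => ?_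
  rw [partitionEntropy_eq hT hP]
  exact h k P hP

theorem entropy_nonneg (hT : MeasurePreserving T μ μ) : 0 ≤ entropy T μ := by
  refine le_trans ?_ (rate_le_entropy hT (P := fun _ => ()) measurable_const)
  exact EReal.coe_nonneg.2 (rate_nonneg hT.measurable measurable_const)

/-- The formula `h(T^n) = n h(T)`, phrased through real upper bounds so that the value `⊤` needs no
separate arithmetic. Later entropy formulas take the same form. -/
theorem entropy_iterate_le_iff (hT : MeasurePreserving T μ μ) {n : ℕ} (hn : 0 < n) (b : ℝ) :
    entropy T^[n] μ ≤ ((n * b : ℝ) : EReal) ↔ entropy T μ ≤ (b : EReal) := by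
  have hT' := hT.measurable
  have hn' : (0 : ℝ) < n := by exact_mod_cast hn
  rw [entropy_le_iff (hT.iterate n), entropy_le_iff hT]
  simp only [EReal.coe_le_coe_iff]
  constructor
  · intro h k P hP
    have h1 := (rate_le_entropy (hT.iterate n) (P := word T P n) (by fun_prop)).trans
      ((entropy_le_iff (b := ((n * b : ℝ) : EReal)) (hT.iterate n)).2
        (fun k P hP => EReal.coe_le_coe_iff.2 (h k P hP)))
    rw [rate_iterate hT hP hn, EReal.coe_le_coe_iff] at h1
    exact le_of_mul_le_mul_left h1 hn'
  · intro h k P hP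
    calc rate T^[n] μ P ≤ rate T^[n] μ (word T P n) := by
          refine rate_mono (hT.iterate n) hP (by fun_prop) fun x y h => ?_
          simpa using word_eq_iff.1 h 0 hn
      _ = n * rate T μ P := rate_iterate hT hP hn
      _ ≤ n * b := mul_le_mul_of_nonneg_left (h k P hP) hn'.le

end Rate

/-! ### Towers -/

/-- `S : X → X` is the tower map over `F : W → W` with the bounded integer height function `r`.
The point at level `i` above `w` is `j i w`; the base point and the level of `y` are `p y` and
`k y`. The measure `m` is, up to the factor `a`, the measure `ν` on every level. -/
structure IsTower {X W : Type*} [MeasurableSpace X] [MeasurableSpace W] (S : X → X) (F : W → W)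
    (m : Measure X) (ν : Measure W) (p : X → W) (k : X → ℕ) (j : ℕ → W → X) (r : W → ℕ) (R : ℕ)
    (a : ℝ≥0∞) : Prop where
  measurable_map : Measurable S
  measurable_base : Measurable p
  measurable_level : Measurable k
  measurable_point : ∀ i, Measurable (j i)
  measurable_height : Measurable r
  height_pos : ∀ w, 0 < r w
  height_le : ∀ w, r w ≤ R
  level_lt : ∀ y, k y < r (p y)
  point_level_base : ∀ y, j (k y) (p y) = y
  base_point : ∀ i w, i < r w → p (j i w) = w
  level_point : ∀ i w, i < r w → k (j i w) = i
  map_point : ∀ i w, i + 1 < r w → S (j i w) = j (i + 1) w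
  map_top : ∀ i w, i + 1 = r w → S (j i w) = j 0 (F w)
  measure_eq : ∀ E, MeasurableSet E → m E = a * ∑ i ∈ Finset.range R, ν {w | i < r w ∧ j i w ∈ E}

namespace IsTower

variable {X W : Type*} [MeasurableSpace X] [MeasurableSpace W] {S : X → X} {F : W → W}
  {m : Measure X} {ν : Measure W} {p : X → W} {k : X → ℕ} {j : ℕ → W → X} {r : W → ℕ} {R : ℕ}
  {a : ℝ≥0∞}

theorem map_cases (h : IsTower S F m ν p k j r R a) (y : X) :
    (k y + 1 < r (p y) ∧ p (S y) = p y ∧ k (S y) = k y + 1) ∨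
      (k y + 1 = r (p y) ∧ p (S y) = F (p y) ∧ k (S y) = 0 ∧ S y = j 0 (F (p y))) := by
  have hk := h.level_lt y
  have hy := h.point_level_base y
  rcases (Nat.succ_le_of_lt hk).lt_or_eq with h1 | h1
  · left
    have h2 := h.map_point _ _ h1
    rw [hy] at h2
    rw [h2]
    exact ⟨h1, h.base_point _ _ h1, h.level_point _ _ h1⟩
  · right
    have h2 := h.map_top _ _ h1
    rw [hy] at h2
    rw [h2]
    exact ⟨h1, h.base_point _ _ (h.height_pos _), h.level_point _ _ (h.height_pos _), rfl⟩

/-- Mass at level `i + 1` comes from level `i`; mass in the base comes from the tops of all columns,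
where invariance of `ν` under `F` enters. -/
theorem measurePreserving (h : IsTower S F m ν p k j r R a) (hF : MeasurePreserving F ν ν) :
    MeasurePreserving S m m := by
  refine ⟨h.measurable_map, ?_⟩
  ext E hE
  rw [Measure.map_apply h.measurable_map hE, h.measure_eq _ hE,
    h.measure_eq _ (h.measurable_map hE)]
  congr 1
  have hm : ∀ i, MeasurableSet {w | i < r w ∧ j i w ∈ E} := fun i =>
    (measurableSet_lt measurable_const h.measurable_height).inter (h.measurable_point i hE)
  set G : Set W := F ⁻¹' (j 0 ⁻¹' E) with hG
  have hGm : MeasurableSet G := hF.measurable (h.measurable_point 0 hE)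
  have hr : ∀ i, MeasurableSet {w | r w = i + 1} := fun i =>
    h.measurable_height (measurableSet_singleton (i + 1))
  -- Over level `i`, the preimage of `E` splits into the columns that continue upward and those of
  -- height exactly `i + 1`, which return to the base.
  have e1 : ∀ i, ν {w | i < r w ∧ j i w ∈ S ⁻¹' E} =
      ν {w | i + 1 < r w ∧ j (i + 1) w ∈ E} + ν ({w | r w = i + 1} ∩ G) := by
    intro i
    rw [← measure_union _ ((hr i).inter hGm)]
    · congr 1
      ext w
      simp only [Set.mem_ofPred_eq, Set.mem_preimage, Set.mem_union, Set.mem_inter_iff, hG]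
      rcases lt_trichotomy (i + 1) (r w) with h1 | h1 | h1
      · rw [h.map_point _ _ h1]
        have : r w ≠ i + 1 := h1.ne'
        have : i < r w := by omega
        tauto
      · rw [h.map_top _ _ h1]
        have : ¬ (i + 1 < r w) := h1.not_lt
        have : i < r w := by omega
        have := h1.symm
        tauto
      · have : ¬ (i + 1 < r w) := by omega
        have : ¬ (i < r w) := by omega
        have : r w ≠ i + 1 := h1.ne
        tauto
    · rw [Set.disjoint_left]
      rintro w ⟨h1, -⟩ ⟨h2, -⟩
      exact h1.ne' h2
  have e2 : ∑ i ∈ Finset.range R, ν ({w | r w = i + 1} ∩ G) = ν {w | 0 < r w ∧ j 0 w ∈ E} := by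
    rw [← measure_biUnion_finset _ fun i _ => (hr i).inter hGm]
    · have : {w | 0 < r w ∧ j 0 w ∈ E} = j 0 ⁻¹' E := by
        ext w
        simp [h.height_pos w]
      rw [this, ← hF.measure_preimage (h.measurable_point 0 hE).nullMeasurableSet]
      congr 1
      ext w
      simp only [Set.mem_iUnion, Finset.mem_range, Set.mem_inter_iff, Set.mem_ofPred_eq, exists_prop,
        ← hG]
      constructor
      · rintro ⟨i, -, -, hw⟩
        exact hw
      · intro hw
        have := h.height_pos w
        have := h.height_le w
        exact ⟨r w - 1, by omega, by omega, hw⟩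
    · intro i _ i' _ hii'
      rw [Function.onFun, Set.disjoint_left]
      rintro w ⟨h1, -⟩ ⟨h2, -⟩
      simp only [Set.mem_ofPred_eq] at h1 h2
      omega
  -- No column reaches level `R`, so shifting the index of the sum by one loses nothing.
  have e3 : ν {w | R < r w ∧ j R w ∈ E} = 0 := by
    convert measure_empty (μ := ν)
    ext w
    simp [(h.height_le w).not_gt]
  simp only [e1]
  rw [Finset.sum_add_distrib, e2,
    ← Finset.sum_range_succ' (fun i => ν {w | i < r w ∧ j i w ∈ E}) R,
    Finset.sum_range_succ, e3, add_zero]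

/-- The level as an element of a finite type. -/
def finLevel (h : IsTower S F m ν p k j r R a) (y : X) : Fin R :=
  ⟨k y, (h.level_lt y).trans_le (h.height_le _)⟩

/-- The top level as an element of a finite type. -/
def topLevel (h : IsTower S F m ν p k j r R a) (w : W) : Fin R :=
  ⟨r w - 1, by have := h.height_pos w; have := h.height_le w; omega⟩

/-- The labelling of the tower by a labelling of the base and the level. -/
def label {α : Type*} (h : IsTower S F m ν p k j r R a) (P : W → α) (y : X) : α × Fin R :=
  (P (p y), h.finLevel y)

theorem measurable_finLevel (h : IsTower S F m ν p k j r R a) : Measurable h.finLevel := by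
  refine measurable_to_countable' fun i => ?_
  convert h.measurable_level (measurableSet_singleton (i : ℕ)) using 1
  ext y
  simp [finLevel, Fin.ext_iff]

theorem measurable_topLevel (h : IsTower S F m ν p k j r R a) : Measurable h.topLevel := by
  refine measurable_to_countable' fun i => ?_
  convert h.measurable_height (measurableSet_singleton (i + 1 : ℕ)) using 1
  ext w
  have := h.height_pos w
  simp only [topLevel, Set.mem_preimage, Set.mem_singleton_iff, Fin.ext_iff]
  omega

/-! ### Entropy of a tower relative to base labels and levels -/

section Label

variable {α : Type*} [Fintype α] [MeasurableSpace α] [MeasurableSingletonClass α]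

theorem measurable_label (h : IsTower S F m ν p k j r R a) {P : W → α} (hP : Measurable P) :
    Measurable (h.label P) :=
  (hP.comp h.measurable_base).prodMk h.measurable_finLevel

theorem label_eq_iff (h : IsTower S F m ν p k j r R a) {P : W → α} {y y' : X} :
    h.label P y = h.label P y' ↔ P (p y) = P (p y') ∧ k y = k y' := by
  simp [label, finLevel]

/-- Since `P` determines the height, two points on the same level with the same base name rise and
return together. Each step uses at most one new base label. -/
theorem word_label_eq (h : IsTower S F m ν p k j r R a) {P : W → α}
    (hr : ∀ w w', P w = P w' → r w = r w') (n : ℕ) (y y' : X) (hk : k y = k y')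
    (hw : ∀ i < n, P (F^[i] (p y)) = P (F^[i] (p y'))) :
    ∀ i < n, h.label P (S^[i] y) = h.label P (S^[i] y') := by
  induction n generalizing y y' with
  | zero => simp
  | succ n ih =>
    have h0 := hw 0 (Nat.succ_pos n)
    simp only [Function.iterate_zero, id_eq] at h0
    have hr0 := hr _ _ h0
    rw [Nat.forall_lt_succ_left]
    refine ⟨h.label_eq_iff.2 ⟨h0, hk⟩, ?_⟩
    simp only [Function.iterate_succ_apply]
    rcases h.map_cases y with ⟨h1, h2, h3⟩ | ⟨h1, h2, h3, -⟩ <;>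
    rcases h.map_cases y' with ⟨h1', h2', h3'⟩ | ⟨h1', h2', h3', -⟩
    · refine ih _ _ (by omega) fun i hi => ?_
      rw [h2, h2']
      exact hw i (by omega)
    · omega
    · omega
    · refine ih _ _ (by omega) fun i hi => ?_
      rw [h2, h2']
      exact hw (i + 1) (by omega)

theorem base_iterate (h : IsTower S F m ν p k j r R a) (d : ℕ) (y : X)
    (hd : k y + d + 1 = r (p y)) : p (S^[d + 1] y) = F (p y) := by
  induction d generalizing y with
  | zero =>
    rcases h.map_cases y with ⟨h1, h2, h3⟩ | ⟨h1, h2, h3, -⟩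
    · omega
    · simpa using h2
  | succ d ih =>
    rcases h.map_cases y with ⟨h1, h2, h3⟩ | ⟨h1, h2, h3, -⟩
    · rw [Function.iterate_succ_apply, ih _ (by rw [h2]; omega), h2]
    · omega

/-- Conversely, every `R` consecutive steps contain a return to the base, so `n * R` tower labels
reveal `n` base labels. -/
theorem word_base_eq (h : IsTower S F m ν p k j r R a) {P : W → α}
    (hr : ∀ w w', P w = P w' → r w = r w') (n : ℕ) (y y' : X)
    (hw : ∀ i < n * R, h.label P (S^[i] y) = h.label P (S^[i] y')) :
    ∀ i < n, P (F^[i] (p y)) = P (F^[i] (p y')) := by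
  induction n generalizing y y' with
  | zero => simp
  | succ n ih =>
    have hky := h.level_lt y
    have hR := h.height_le (p y)
    have hmul : (n + 1) * R = n * R + R := by ring
    rw [hmul] at hw
    obtain ⟨h0, hk⟩ := h.label_eq_iff.1 (hw 0 (by omega))
    simp only [Function.iterate_zero, id_eq] at h0 hk
    have hr0 := hr _ _ h0
    rw [Nat.forall_lt_succ_left]
    refine ⟨h0, ?_⟩
    simp only [Function.iterate_succ_apply]
    -- Equal heights and levels make both points return after the same number of steps.
    have e1 := h.base_iterate (r (p y) - k y - 1) y (by omega)
    have e2 := h.base_iterate (r (p y) - k y - 1) y' (by omega)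
    rw [← e1, ← e2]
    refine ih _ _ fun i hi => ?_
    rw [← Function.iterate_add_apply, ← Function.iterate_add_apply]
    exact hw _ (by omega)

/-- If the next label lies on level `0`, the present point is the top of its column, so in
`measure_eq` only the level prescribed by `q` contributes. -/
theorem real_eq_of_return (h : IsTower S F m ν p k j r R a) {P : W → α} (hP : Measurable P)
    {n : ℕ} (q : α × Fin R) (v : Fin (n + 1) → α × Fin R) (hv : (v 0).2.1 = 0) :
    m.real ((fun y => (h.label P y, word S (h.label P) (n + 1) (S y))) ⁻¹' {(q, v)}) =
      a.toReal * ν.real ((fun w => ((P w, h.topLevel w),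
        word S (h.label P) (n + 1) (j 0 (F w)))) ⁻¹' {(q, v)}) := by
  have hS := h.measurable_map
  have hl := h.measurable_label hP
  have hE : MeasurableSet
      ((fun y => (h.label P y, word S (h.label P) (n + 1) (S y))) ⁻¹' {(q, v)}) :=
    (hl.prodMk ((measurable_word hS hl (n + 1)).comp hS)) (measurableSet_singleton _)
  rw [Measure.real, Measure.real, h.measure_eq _ hE, ENNReal.toReal_mul]
  congr 2
  rw [Finset.sum_eq_single q.2.1]
  · congr 1
    ext w
    simp only [Set.mem_ofPred_eq, Set.mem_preimage, Set.mem_singleton_iff, Prod.mk.injEq]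
    have hpos := h.height_pos w
    constructor
    · rintro ⟨h1, h2, h3⟩
      have h4 : k (S (j q.2 w)) = 0 := by
        rw [← h3] at hv
        exact hv
      rcases h.map_cases (j q.2 w) with ⟨-, -, h5⟩ | ⟨h5, -, -, h6⟩
      · omega
      · rw [h.base_point _ _ h1] at h5 h6
        rw [h.level_point _ _ h1] at h5
        rw [h6] at h3
        refine ⟨?_, h3⟩
        rw [← h2]
        simp only [label, h.base_point _ _ h1, Prod.mk.injEq, true_and]
        simp only [topLevel, finLevel, Fin.mk.injEq, h.level_point _ _ h1]
        omega
    · rintro ⟨h1, h2⟩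
      have h3 : q.2.1 = r w - 1 := by rw [← h1]; rfl
      have h4 : q.2.1 < r w := by omega
      refine ⟨h4, ?_, ?_⟩
      · rw [← h1]
        simp only [label, Prod.mk.injEq]
        have h5 : r w - 1 < r w := by omega
        refine ⟨by rw [show (h.topLevel w).1 = r w - 1 from rfl, h.base_point _ _ h5], ?_⟩
        rw [Fin.ext_iff]
        exact h.level_point _ _ h5
      · rw [h.map_top _ _ (by omega), h2]
  · intro i _ hi
    convert measure_empty (μ := ν)
    rw [Set.eq_empty_iff_forall_notMem]
    rintro w ⟨h1, h2⟩
    simp only [Set.mem_preimage, Set.mem_singleton_iff, Prod.mk.injEq] at h2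
    apply hi
    rw [← h2.1]
    exact (h.level_point _ _ h1).symm
  · intro hq
    simp at hq

/-- Conditional entropy is homogeneous in the masses: the terms with `negMulLog c` cancel in the
difference. -/
theorem sum_negMulLog_mul_sub {ι : Type*} [Fintype ι] (x : ι → ℝ) (c : ℝ) :
    ∑ i, Real.negMulLog (c * x i) - Real.negMulLog (∑ i, c * x i) =
      c * (∑ i, Real.negMulLog (x i) - Real.negMulLog (∑ i, x i)) := by
  rw [← Finset.mul_sum]
  simp only [Real.negMulLog_mul, Finset.sum_add_distrib, ← Finset.mul_sum, ← Finset.sum_mul]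
  ring

/-- Sorts conditional entropy by the value of the condition, so that tower and base can be compared
future by future. -/
theorem condShannon_eq_sum [IsProbabilityMeasure m] {β : Type*} [Fintype β] [MeasurableSpace β]
    [MeasurableSingletonClass β] {A : X → α} {B : X → β} (hA : Measurable A) :
    condShannon m A B = ∑ b, (∑ a, Real.negMulLog (m.real ((fun x => (A x, B x)) ⁻¹' {(a, b)})) -
      Real.negMulLog (∑ a, m.real ((fun x => (A x, B x)) ⁻¹' {(a, b)}))) := by
  rw [condShannon, Finset.sum_sub_distrib, shannon, Fintype.sum_prod_type, Finset.sum_comm]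
  congr 1
  refine Finset.sum_congr rfl fun b _ => ?_
  rw [← sum_real_inter_fiber hA]
  congr 1
  refine Finset.sum_congr rfl fun a _ => ?_
  congr 1
  ext x
  simp only [Set.mem_preimage, Set.mem_singleton_iff, Prod.mk.injEq, Set.mem_inter_iff]
  tauto

/-- The labels above the base carry no information given the future; in the base it is the
information on the base label given the name of the image under the base map. -/
theorem condShannon_label (h : IsTower S F m ν p k j r R a) (hF : Measurable F)
    [IsProbabilityMeasure m] [IsProbabilityMeasure ν] {P : W → α} (hP : Measurable P)
    (hr : ∀ w w', P w = P w' → r w = r w') (n : ℕ) :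
    condShannon m (h.label P) (fun y => word S (h.label P) (n + 1) (S y)) =
      a.toReal * condShannon ν P (fun w => word S (h.label P) (n + 1) (j 0 (F w))) := by
  have hS := h.measurable_map
  have hl := h.measurable_label hP
  have ht := h.measurable_topLevel
  have hj := h.measurable_point 0
  have e1 : condShannon ν P (fun w => word S (h.label P) (n + 1) (j 0 (F w))) =
      condShannon ν (fun w => (P w, h.topLevel w))
        (fun w => word S (h.label P) (n + 1) (j 0 (F w))) := by
    unfold condShannon
    congr 1
    refine shannon_congr (by fun_prop) (by fun_prop) fun w w' => ?_
    simp only [Prod.mk.injEq]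
    have := hr w w'
    simp only [topLevel, Fin.mk.injEq]
    constructor
    · rintro ⟨h1, h2⟩
      exact ⟨⟨h1, by rw [this h1]⟩, h2⟩
    · rintro ⟨⟨h1, -⟩, h2⟩
      exact ⟨h1, h2⟩
  rw [e1, condShannon_eq_sum hl, condShannon_eq_sum (hP.prodMk ht), Finset.mul_sum]
  refine Finset.sum_congr rfl fun v _ => ?_
  -- A future starting on level `0` follows a return and gives `a` times the base term. Any other
  -- future determines the present label, namely the same base label one level lower, and gives
  -- zero.
  by_cases hv : (v 0).2.1 = 0
  · simp only [h.real_eq_of_return hP _ v hv]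
    exact sum_negMulLog_mul_sub _ _
  · have z1 : ∀ q, (fun w => ((P w, h.topLevel w), word S (h.label P) (n + 1) (j 0 (F w)))) ⁻¹'
        {(q, v)} = ∅ := by
      intro q
      rw [Set.eq_empty_iff_forall_notMem]
      intro w hw
      simp only [Set.mem_preimage, Set.mem_singleton_iff, Prod.mk.injEq] at hw
      apply hv
      rw [← hw.2]
      exact h.level_point 0 _ (h.height_pos _)
    have z2 : ∀ q, q ≠ ((v 0).1, ⟨(v 0).2.1 - 1, by omega⟩) →
        (fun y => (h.label P y, word S (h.label P) (n + 1) (S y))) ⁻¹' {(q, v)} = ∅ := by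
      intro q hq
      rw [Set.eq_empty_iff_forall_notMem]
      intro y hy
      simp only [Set.mem_preimage, Set.mem_singleton_iff, Prod.mk.injEq] at hy
      have h0 : h.label P (S y) = v 0 := by rw [← hy.2]; rfl
      apply hq
      rw [← hy.1]
      have h1 : P (p (S y)) = (v 0).1 := by rw [← h0]; rfl
      have h2 : k (S y) = (v 0).2.1 := by rw [← h0]; rfl
      rcases h.map_cases y with ⟨-, h3, h4⟩ | ⟨-, -, h4, -⟩
      · rw [h3] at h1
        rw [h4] at h2
        refine Prod.ext h1 (Fin.ext ?_)
        simp only [← h2]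
        rfl
      · omega
    simp only [z1, measureReal_empty, Real.negMulLog_zero, Finset.sum_const_zero, sub_self,
      mul_zero]
    rw [Fintype.sum_eq_single _ fun q hq => by rw [z2 q hq]; simp,
      Fintype.sum_eq_single _ fun q hq => by rw [z2 q hq]; simp, sub_self]

/-- Both rates become limits of conditional entropies of `P` on the base, given either the tower
name or the base name of the future. Each kind of name determines the other up to a change of
length. -/
theorem rate_label (h : IsTower S F m ν p k j r R a) (hF : MeasurePreserving F ν ν)
    [IsProbabilityMeasure m] [IsProbabilityMeasure ν] {P : W → α} (hP : Measurable P)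
    (hr : ∀ w w', P w = P w' → r w = r w') :
    rate S m (h.label P) = a.toReal * rate F ν P := by
  have hS := h.measurable_map
  have hl := h.measurable_label hP
  have hj := h.measurable_point 0
  have hF' := hF.measurable
  have hp0 : ∀ w, p (j 0 w) = w := fun w => h.base_point 0 w (h.height_pos w)
  have hk0 : ∀ w, k (j 0 w) = 0 := fun w => h.level_point 0 w (h.height_pos w)
  have hR : 0 < R := by
    obtain ⟨w⟩ := nonempty_of_isProbabilityMeasure ν
    exact (h.height_pos w).trans_le (h.height_le w)
  have t1 := tendsto_condShannon_word (μ := m) hS hl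
  have t2 := (tendsto_condShannon_word (μ := ν) hF' hP).const_mul a.toReal
  apply le_antisymm
  -- A tower name of length `n * R + 1` determines the base name of length `n`; the extra letter is
  -- what `condShannon_label` needs to see the next level.
  · refine le_of_tendsto_of_tendsto'
      ((t1.comp (tendsto_add_atTop_nat 1)).comp (tendsto_id.atTop_mul_const' hR)) t2 fun n => ?_
    simp only [Function.comp_apply, id_eq]
    rw [h.condShannon_label hF' hP hr]
    refine mul_le_mul_of_nonneg_left ?_ ENNReal.toReal_nonneg
    refine condShannon_anti hP (by fun_prop) (by fun_prop) fun w w' => ?_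
    simp only [word_eq_iff]
    intro hw
    have := h.word_base_eq hr n _ _ fun i hi => hw i (by omega)
    simpa only [hp0] using this
  · refine le_of_tendsto_of_tendsto' (t2.comp (tendsto_add_atTop_nat 1))
      (t1.comp (tendsto_add_atTop_nat 1)) fun n => ?_
    simp only [Function.comp_apply]
    rw [h.condShannon_label hF' hP hr]
    refine mul_le_mul_of_nonneg_left ?_ ENNReal.toReal_nonneg
    refine condShannon_anti hP (by fun_prop) (by fun_prop) fun w w' => ?_
    simp only [word_eq_iff]
    intro hw
    refine h.word_label_eq hr (n + 1) _ _ (by rw [hk0, hk0]) ?_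
    simpa only [hp0] using hw

end Label

/-- Abramov's formula for towers: the entropy of the tower map is `a` times the entropy of the
base map. -/
theorem entropy_le_iff (h : IsTower S F m ν p k j r R a) (hF : MeasurePreserving F ν ν)
    [IsProbabilityMeasure m] [IsProbabilityMeasure ν] (ha : 0 < a.toReal) (b : ℝ) :
    entropy S m ≤ ((a.toReal * b : ℝ) : EReal) ↔ entropy F ν ≤ (b : EReal) := by
  have hS := h.measurePreserving hF
  -- The height is joined to every base partition, so that labels determine heights as `rate_label`
  -- requires.
  have hrm : Measurable fun w => (⟨r w, Nat.lt_succ_of_le (h.height_le w)⟩ : Fin (R + 1)) := by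
    refine measurable_to_countable' fun i => ?_
    convert h.measurable_height (measurableSet_singleton (i : ℕ)) using 1
    ext w
    simp [Fin.ext_iff]
  constructor
  · intro hb
    rw [SuspensionPressure.entropy_le_iff hF]
    intro l P hP
    have hP' := hP.prodMk hrm
    have h1 := (rate_le_entropy hS (h.measurable_label hP')).trans hb
    rw [h.rate_label hF hP' fun w w' hw => by simpa using (Prod.ext_iff.1 hw).2,
      EReal.coe_le_coe_iff] at h1
    rw [EReal.coe_le_coe_iff]
    exact (rate_mono hF hP hP' fun w w' hw => (Prod.ext_iff.1 hw).1).trans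
      (le_of_mul_le_mul_left h1 ha)
  · intro hb
    rw [SuspensionPressure.entropy_le_iff hS]
    intro l Q hQ
    -- The base label lists the `Q`-labels of the whole column; with the level it determines `Q`.
    -- Entries with `i ≥ r w` are meaningless but harmless.
    have hjm : Measurable fun w => fun i : Fin R => Q (j i w) :=
      measurable_pi_lambda _ fun i => hQ.comp (h.measurable_point i)
    have hP' := hjm.prodMk hrm
    have h1 := (rate_le_entropy hF hP').trans hb
    rw [EReal.coe_le_coe_iff] at h1 ⊢
    refine le_trans (rate_mono hS hQ (h.measurable_label hP') fun y y' hy => ?_)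
      ((h.rate_label hF hP' fun w w' hw => by simpa using (Prod.ext_iff.1 hw).2).trans_le
        (mul_le_mul_of_nonneg_left h1 ha.le))
    obtain ⟨h2, h3⟩ := h.label_eq_iff.1 hy
    have h4 := congr_fun (Prod.ext_iff.1 h2).1 (h.finLevel y)
    simp only [finLevel, h.point_level_base] at h4
    rw [h4, h3, h.point_level_base]

end IsTower

/-! ### Circle extensions -/

/-- The circle, as the interval `[0, 1)`. -/
abbrev Circ : Type := Set.Ico (0 : ℝ) 1

/-- The fractional part, as a map to the circle. -/
noncomputable def toCirc (x : ℝ) : Circ := ⟨Int.fract x, Int.fract_nonneg x, Int.fract_lt_one x⟩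

@[fun_prop]
theorem measurable_toCirc : Measurable toCirc := measurable_fract.subtype_mk

theorem toCirc_coe (u : Circ) : toCirc u = u :=
  Subtype.ext (Int.fract_eq_self.2 u.2)

theorem toCirc_add_toCirc (x y : ℝ) : toCirc (toCirc x + y) = toCirc (x + y) := by
  refine Subtype.ext ?_
  simp only [toCirc]
  rw [Int.fract_eq_fract]
  exact ⟨-⌊x⌋, by rw [← Int.self_sub_floor]; push_cast; ring⟩

/-- Lebesgue measure on the circle. -/
noncomputable def circMeasure : Measure Circ := Measure.comap Subtype.val volume

theorem measurePreserving_coe_circ :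
    MeasurePreserving (Subtype.val : Circ → ℝ) circMeasure (volume.restrict (Set.Ico 0 1)) :=
  measurePreserving_subtype_coe measurableSet_Ico

instance : IsProbabilityMeasure circMeasure := by
  constructor
  have := measurePreserving_coe_circ.measure_preimage (s := Set.univ) nullMeasurableSet_univ
  simpa using this

/-- Any interval `[a, a + 1)` is a fundamental domain: its image measure comes from Haar measure on
`UnitAddCircle`, hence is independent of `a`. -/
theorem map_toCirc (a : ℝ) : (volume.restrict (Set.Ico a (a + 1))).map toCirc = circMeasure := by
  have key : ∀ a : ℝ, (volume.restrict (Set.Ico a (a + 1))).map toCirc =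
      (volume : Measure UnitAddCircle).map fun θ =>
        (⟨(AddCircle.measurableEquivIco 1 0 θ).1,
          by simpa using (AddCircle.measurableEquivIco (1 : ℝ) 0 θ).2⟩ : Circ) := by
    intro a
    have hm : Measurable fun θ : UnitAddCircle => (⟨(AddCircle.measurableEquivIco 1 0 θ).1,
          by simpa using (AddCircle.measurableEquivIco (1 : ℝ) 0 θ).2⟩ : Circ) :=
      (measurable_subtype_coe.comp (AddCircle.measurableEquivIco (1 : ℝ) 0).measurable).subtype_mk
    rw [← (UnitAddCircle.measurePreserving_mk a).map_eq,
      Measure.map_map hm AddCircle.measurable_mk', restrict_Ico_eq_restrict_Ioc]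
    congr 1
    ext x
    simp only [toCirc, Function.comp_apply]
    have := AddCircle.coe_equivIco_mk_apply (p := (1 : ℝ)) x
    simp only [div_one, mul_one] at this
    exact this.symm
  rw [key a, ← key 0, zero_add, ← measurePreserving_coe_circ.map_eq,
    Measure.map_map measurable_toCirc measurable_subtype_coe]
  have : toCirc ∘ Subtype.val = id := funext toCirc_coe
  rw [this, Measure.map_id]

theorem map_rotation (a : ℝ) : circMeasure.map (fun u : Circ => toCirc (u + a)) = circMeasure := by
  conv_rhs => rw [← map_toCirc a]
  have h : MeasurePreserving (fun x : ℝ => x + a) (volume.restrict (Set.Ico 0 1))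
      (volume.restrict (Set.Ico a (a + 1))) := by
    have := (measurePreserving_add_right volume a).restrict_preimage
      (measurableSet_Ico (a := a) (b := a + 1))
    simpa using this
  rw [← h.map_eq, ← measurePreserving_coe_circ.map_eq, Measure.map_map (by fun_prop) (by fun_prop),
    Measure.map_map (by fun_prop) (by fun_prop)]
  rfl

/-- The circle extension of `T` by the rotations through `ω`. -/
noncomputable def circleExt {Z : Type*} (T : Z → Z) (ω : Z → ℝ) (z : Z × Circ) : Z × Circ :=
  (T z.1, toCirc (z.2 + ω z.1))

section CircleExt

variable {Z : Type*} [MeasurableSpace Z] {T : Z → Z} {ω : Z → ℝ} {μ : Measure Z}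
  [IsProbabilityMeasure μ]

@[fun_prop]
theorem measurable_circleExt (hT : Measurable T) (hω : Measurable ω) :
    Measurable (circleExt T ω) := by
  unfold circleExt
  fun_prop

theorem measurePreserving_circleExt (hT : MeasurePreserving T μ μ) (hω : Measurable ω) :
    MeasurePreserving (circleExt T ω) (μ.prod circMeasure) (μ.prod circMeasure) :=
  hT.skew_product (g := fun x (u : Circ) => toCirc (u + ω x))
    (by unfold Function.uncurry; fun_prop) (Eventually.of_forall fun x => map_rotation (ω x))

/-- Iterates stay in the class of circle extensions, with Birkhoff sums as angles; hence a bound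
uniform in the angle function may be divided by `n`. -/
theorem circleExt_iterate (T : Z → Z) (ω : Z → ℝ) (n : ℕ) :
    (circleExt T ω)^[n] = circleExt T^[n] (fun x => ∑ i ∈ Finset.range n, ω (T^[i] x)) := by
  induction n with
  | zero =>
    ext1 z
    simp [circleExt, toCirc_coe]
  | succ n ih =>
    ext1 z
    rw [Function.iterate_succ_apply', ih]
    simp only [circleExt, Function.iterate_succ_apply', toCirc_add_toCirc, Finset.sum_range_succ,
      add_assoc]

theorem floor_mul_lt (q : ℕ) (hq : 0 < q) (u : Circ) : ⌊(q : ℝ) * u⌋₊ < q := by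
  have hq' : (0 : ℝ) < q := by exact_mod_cast hq
  rw [Nat.floor_lt (mul_nonneg hq'.le u.2.1)]
  exact mul_lt_of_lt_one_right hq' u.2.2

/-- The partition of the circle into `q` intervals of equal length. -/
noncomputable def circLabel (q : ℕ) (hq : 0 < q) (u : Circ) : Fin q :=
  ⟨⌊(q : ℝ) * u⌋₊, floor_mul_lt q hq u⟩

@[fun_prop]
theorem measurable_circLabel (q : ℕ) (hq : 0 < q) : Measurable (circLabel q hq) := by
  refine measurable_to_countable' fun i => ?_
  have : Measurable fun u : Circ => ⌊(q : ℝ) * u⌋₊ :=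
    Nat.measurable_floor.comp (measurable_subtype_coe.const_mul _)
  convert this (measurableSet_singleton (i : ℕ)) using 1
  ext u
  simp [circLabel, Fin.ext_iff]

theorem circLabel_of_dvd {q q' : ℕ} (hq : 0 < q) (hq' : 0 < q') (h : q ∣ q') {u v : Circ}
    (huv : circLabel q' hq' u = circLabel q' hq' v) : circLabel q hq u = circLabel q hq v := by
  obtain ⟨d, rfl⟩ := h
  have hd : (d : ℝ) ≠ 0 := by
    rintro h
    simp only [Nat.cast_eq_zero] at h
    simp [h] at hq'
  have key : ∀ u : Circ, ⌊(q : ℝ) * u⌋₊ = ⌊((q * d : ℕ) : ℝ) * u⌋₊ / d := fun u => by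
    rw [← Nat.floor_div_natCast]
    congr 1
    push_cast
    field_simp
  simp only [circLabel, Fin.mk.injEq] at huv ⊢
  rw [key u, key v, huv]

/-- Adding two numbers known to precision `1 / q` leaves only a carry of `0` or `1` undetermined. -/
theorem circLabel_rotation (q : ℕ) (hq : 0 < q) (u : Circ) (a : ℝ) :
    (circLabel q hq (toCirc (u + a))).1 =
        ((circLabel q hq u).1 + (circLabel q hq (toCirc a)).1) % q ∨
      (circLabel q hq (toCirc (u + a))).1 =
        ((circLabel q hq u).1 + (circLabel q hq (toCirc a)).1 + 1) % q := by
  have hlt := (circLabel q hq (toCirc (u + a))).2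
  obtain ⟨d, hd⟩ : ∃ d : ℕ, (toCirc (u + a) : ℝ) + d = u + toCirc a := by
    have h1 : toCirc (u + a) = toCirc (u + toCirc a) := by
      rw [add_comm _ ((toCirc a : Circ) : ℝ), toCirc_add_toCirc, add_comm]
    have h2 : (0 : ℝ) ≤ u + toCirc a := add_nonneg u.2.1 (toCirc a).2.1
    refine ⟨⌊(u + toCirc a : ℝ)⌋₊, ?_⟩
    rw [h1]
    have := Int.fract_add_floor ((u : ℝ) + toCirc a)
    rw [natCast_floor_eq_intCast_floor h2]
    exact this
  have hq' : (0 : ℝ) < q := by exact_mod_cast hq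
  set x := toCirc (u + a)
  set y := toCirc a
  have fl : ∀ v : Circ, ((circLabel q hq v).1 : ℝ) ≤ q * v ∧
      (q * v : ℝ) < (circLabel q hq v).1 + 1 := fun v =>
    ⟨Nat.floor_le (mul_nonneg hq'.le v.2.1), Nat.lt_floor_add_one _⟩
  obtain ⟨a1, a2⟩ := fl x
  obtain ⟨b1, b2⟩ := fl y
  obtain ⟨c1, c2⟩ := fl u
  set X := (circLabel q hq x).1
  set V := (circLabel q hq y).1
  set U := (circLabel q hq u).1
  have e : (q * x + q * d : ℝ) = q * u + q * y := by rw [← mul_add, hd, mul_add]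
  have h1 : X + q * d < U + V + 2 := by
    have : (X + q * d : ℝ) < U + V + 2 := by linarith
    exact_mod_cast this
  have h2 : U + V < X + q * d + 1 := by
    have : (U + V : ℝ) < X + q * d + 1 := by linarith
    exact_mod_cast this
  have h3 : (X + q * d) % q = X := by
    rw [Nat.add_mul_mod_self_left, Nat.mod_eq_of_lt hlt]
  rcases (by omega : X + q * d = U + V ∨ X + q * d = U + V + 1) with h | h
  · left
    rw [← h, h3]
  · right
    rw [← h, h3]

/-- The initial datum `J` costs at most `log (card γ)` once, which vanishes after division by `n`.
-/
theorem rate_le_of_word_eq {X α β γ : Type*} [MeasurableSpace X] [Fintype α] [MeasurableSpace α]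
    [MeasurableSingletonClass α] [Fintype β] [MeasurableSpace β] [MeasurableSingletonClass β]
    [Fintype γ] [MeasurableSpace γ] [MeasurableSingletonClass γ] {m : Measure X}
    [IsProbabilityMeasure m] {S : X → X} (hS : MeasurePreserving S m m) {A : X → α} {B : X → β}
    {J : X → γ} (hA : Measurable A) (hB : Measurable B) (hJ : Measurable J)
    (h : ∀ n x y, J x = J y → word S B n x = word S B n y → word S A n x = word S A n y) :
    rate S m A ≤ rate S m B := by
  have hS' := hS.measurable
  have h1 : Tendsto (fun n : ℕ => Real.log (Fintype.card γ) / (n : ℝ)) atTop (nhds 0) :=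
    tendsto_const_div_atTop_nhds_zero_nat _
  have h2 := h1.add (tendsto_shannon_word hS hB)
  rw [zero_add] at h2
  refine le_of_tendsto_of_tendsto' (tendsto_shannon_word hS hA) h2 fun n => ?_
  rw [← add_div]
  gcongr
  calc shannon m (word S A n) ≤ shannon m (fun x => (J x, word S B n x)) :=
        shannon_mono (by fun_prop) (by fun_prop) fun x y hxy =>
          h n x y (Prod.ext_iff.1 hxy).1 (Prod.ext_iff.1 hxy).2
    _ ≤ shannon m J + shannon m (word S B n) := shannon_prod_le hJ (by fun_prop)
    _ ≤ _ := by gcongr; exact shannon_le_log_card hJ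

/-- One iterate of a circle extension creates at most `log 2` of entropy on the fibres. -/
theorem rate_circleExt_le (hT : MeasurePreserving T μ μ) (hω : Measurable ω) {α : Type*}
    [Fintype α] [MeasurableSpace α] [MeasurableSingletonClass α] {P : Z → α} (hP : Measurable P)
    (q : ℕ) (hq : 0 < q) :
    rate (circleExt T ω) (μ.prod circMeasure) (fun z => (P z.1, circLabel q hq z.2)) ≤
      rate T μ (fun x => (P x, circLabel q hq (toCirc (ω x)))) + Real.log 2 := by
  have hT' := hT.measurable
  have hF := measurePreserving_circleExt hT hω
  set F := circleExt T ω with hFdef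
  have hF' := hF.measurable
  set P' : Z → α × Fin q := fun x => (P x, circLabel q hq (toCirc (ω x))) with hP'def
  have hP' : Measurable P' := by fun_prop
  set J : Z × Circ → Fin q := fun z => circLabel q hq z.2 with hJdef
  have hJ : Measurable J := by fun_prop
  -- The carry bit: with the intervals of `z.2` and of the angle, it determines the next interval.
  set C : Z × Circ → Prop := fun z =>
    (J (F z)).1 = ((J z).1 + (circLabel q hq (toCirc (ω z.1))).1) % q with hCdef
  have hC : Measurable C := by
    have h1 : Measurable fun z : Z × Circ => (J (F z)).1 :=
      (measurable_of_finite fun i : Fin q => i.1).comp (hJ.comp hF')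
    have h2 : Measurable fun z : Z × Circ =>
        ((J z).1 + (circLabel q hq (toCirc (ω z.1))).1) % q :=
      (measurable_of_finite fun i : Fin q × Fin q => (i.1.1 + i.2.1) % q).comp
        (hJ.prodMk (by fun_prop : Measurable fun z : Z × Circ => circLabel q hq (toCirc (ω z.1))))
    exact measurableSet_setOfPred.1 (measurableSet_eq_fun h1 h2)
  have step : ∀ z z', P' z.1 = P' z'.1 → J z = J z' → C z = C z' → J (F z) = J (F z') := by
    intro z z' h1 h2 h3
    have h4 := (Prod.ext_iff.1 h1).2
    simp only [hP'def] at h4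
    refine Fin.ext ?_
    by_cases hc : C z
    · have hc' : C z' := h3 ▸ hc
      simp only [hCdef] at hc hc'
      rw [hc, hc', h2, h4]
    · have hc' : ¬ C z' := h3 ▸ hc
      have r1 := (circLabel_rotation q hq z.2 (ω z.1)).resolve_left hc
      have r2 := (circLabel_rotation q hq z'.2 (ω z'.1)).resolve_left hc'
      calc _ = _ := r1
        _ = _ := by rw [h4]; simp only [hJdef] at h2; rw [h2]
        _ = _ := r2.symm
  -- The initial interval, the angle labels and the carries determine all later intervals by
  -- induction. Afterwards `b2` pays `log 2` for the carry, and what remains depends on the base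
  -- alone.
  have b1 : rate F (μ.prod circMeasure) (fun z => (P' z.1, J z)) ≤
      rate F (μ.prod circMeasure) (fun z => (P' z.1, C z)) := by
    refine rate_le_of_word_eq hF (by fun_prop) (by fun_prop) hJ fun n z z' hz hw => ?_
    simp only [word_eq_iff, Prod.mk.injEq] at hw ⊢
    have : ∀ i < n, J (F^[i] z) = J (F^[i] z') := by
      intro i
      induction i with
      | zero => exact fun _ => hz
      | succ i ih =>
        intro hi
        obtain ⟨w1, w2⟩ := hw i (by omega)
        rw [Function.iterate_succ_apply', Function.iterate_succ_apply']
        exact step _ _ w1 (ih (by omega)) w2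
    exact fun i hi => ⟨(hw i hi).1, this i hi⟩
  have b2 := rate_prod_le (Q := C) hF (hP'.comp measurable_fst) hC
  have b3 := rate_comp (T := F) (S := T) (measurePreserving_fst (μ := μ) (ν := circMeasure))
    (fun _ => rfl) hT' hP'
  have b4 : rate F (μ.prod circMeasure) (fun z => (P z.1, circLabel q hq z.2)) ≤
      rate F (μ.prod circMeasure) (fun z => (P' z.1, J z)) := by
    refine rate_mono hF (by fun_prop) (by fun_prop) fun z z' hz => ?_
    simp only [Prod.mk.injEq, hP'def, hJdef] at hz ⊢
    exact ⟨hz.1.1, hz.2⟩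
  simp only [Function.comp_apply, Fintype.card_prop] at b2
  calc _ ≤ _ := b4
    _ ≤ _ := b1
    _ ≤ _ := b2
    _ = _ := by rw [← b3]; norm_num; rfl

/-- The algebra of sets determined by a finite partition of the base and a partition of the circle
into intervals of equal length. -/
def boxAlgebra (Z : Type*) [MeasurableSpace Z] : Set (Set (Z × Circ)) :=
  {s | MeasurableSet s ∧ ∃ (q : ℕ) (hq : 0 < q) (n : ℕ) (P : Z → Fin n), Measurable P ∧
    ∀ z z' : Z × Circ, P z.1 = P z'.1 → circLabel q hq z.2 = circLabel q hq z'.2 →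
      (z ∈ s ↔ z' ∈ s)}

theorem isSetAlgebra_boxAlgebra : IsSetAlgebra (boxAlgebra Z) where
  empty_mem := ⟨MeasurableSet.empty, 1, one_pos, 1, fun _ => 0, measurable_const, by simp⟩
  compl_mem := by
    rintro s ⟨hs, q, hq, n, P, hP, h⟩
    exact ⟨hs.compl, q, hq, n, P, hP, fun z z' h1 h2 => not_congr (h z z' h1 h2)⟩
  union_mem := by
    rintro s t ⟨hs, q, hq, n, P, hP, h⟩ ⟨ht, q', hq', n', P', hP', h'⟩
    refine ⟨hs.union ht, q * q', Nat.mul_pos hq hq', n * n',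
      fun x => finProdFinEquiv (P x, P' x),
      (measurable_of_finite finProdFinEquiv).comp (hP.prodMk hP'), fun z z' h1 h2 => ?_⟩
    have h3 := finProdFinEquiv.injective h1
    rw [Prod.mk.injEq] at h3
    exact or_congr (h z z' h3.1 (circLabel_of_dvd hq _ (dvd_mul_right _ _) h2))
      (h' z z' h3.2 (circLabel_of_dvd hq' _ (dvd_mul_left _ _) h2))

theorem generateFrom_boxAlgebra :
    (Prod.instMeasurableSpace : MeasurableSpace (Z × Circ)) =
      MeasurableSpace.generateFrom (boxAlgebra Z) := by
  refine le_antisymm (sup_le ?_ ?_) (MeasurableSpace.generateFrom_le fun s hs => hs.1)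
  · rintro _ ⟨s, hs, rfl⟩
    classical
    refine MeasurableSpace.measurableSet_generateFrom
      ⟨measurable_fst hs, 1, one_pos, 2, fun x => if x ∈ s then 1 else 0,
        Measurable.ite hs measurable_const measurable_const, fun z z' h _ => ?_⟩
    by_cases h1 : z.1 ∈ s <;> by_cases h2 : z'.1 ∈ s <;> simp_all
  · rw [show (Subtype.instMeasurableSpace : MeasurableSpace Circ) =
        MeasurableSpace.comap Subtype.val (borel ℝ) by
          rw [← BorelSpace.measurable_eq (α := ℝ)]; rfl,
      Real.borel_eq_generateFrom_Iio_rat, MeasurableSpace.comap_comp,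
      MeasurableSpace.comap_generateFrom]
    refine MeasurableSpace.generateFrom_le ?_
    rintro _ ⟨s, hs, rfl⟩
    simp only [Set.mem_iUnion, Set.mem_singleton_iff] at hs
    obtain ⟨a, rfl⟩ := hs
    refine MeasurableSpace.measurableSet_generateFrom
      ⟨(measurable_subtype_coe.comp measurable_snd) measurableSet_Iio, a.den, a.den_pos, 1,
        fun _ => 0, measurable_const, fun z z' _ h => ?_⟩
    -- For `a = num / den`, the condition `u < a` reads `⌊den * u⌋ < num`, so `den` intervals decide
    -- it. A negative numerator gives the empty set, matching `toNat = 0`.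
    have key : ∀ z : Z × Circ, z ∈ (Subtype.val ∘ Prod.snd) ⁻¹' Set.Iio (a : ℝ) ↔
        (circLabel a.den a.den_pos z.2).1 < a.num.toNat := by
      intro z
      have hd : (0 : ℝ) < a.den := by exact_mod_cast a.den_pos
      have h0 : (0 : ℝ) ≤ a.den * z.2 := mul_nonneg hd.le z.2.2.1
      simp only [circLabel, Set.mem_preimage, Function.comp_apply, Set.mem_Iio]
      rw [Nat.floor_lt h0, Rat.cast_def, lt_div_iff₀' hd]
      rcases le_or_gt 0 a.num with hn | hn
      · rw [show ((a.num.toNat : ℕ) : ℝ) = (a.num : ℝ) by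
          exact_mod_cast congrArg (Int.cast (R := ℝ)) (Int.toNat_of_nonneg hn)]
      · rw [Int.toNat_of_nonpos hn.le]
        have : (a.num : ℝ) < 0 := by exact_mod_cast hn
        constructor <;> intro h <;> simp at h ⊢ <;> linarith
    rw [key, key, h]

/-- Box partitions satisfy the bound by `rate_circleExt_le`; the others are approximated by them in
measure, and `rate_le_add_condShannon` carries the bound to the limit. -/
theorem entropy_circleExt_le (hT : MeasurePreserving T μ μ) (hω : Measurable ω) {b : ℝ}
    (hb : entropy T μ ≤ (b : EReal)) :
    entropy (circleExt T ω) (μ.prod circMeasure) ≤ ((b + Real.log 2 : ℝ) : EReal) := by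
  have hF := measurePreserving_circleExt hT hω
  have hF' := hF.measurable
  rw [entropy_le_iff hF]
  intro k Q hQ
  rw [EReal.coe_le_coe_iff]
  have hdense := Measure.MeasureDense.of_generateFrom_isSetAlgebra_finite
    (μ := μ.prod circMeasure) isSetAlgebra_boxAlgebra generateFrom_boxAlgebra
  have hex : ∀ (n : ℕ) (a : Fin k), ∃ t ∈ boxAlgebra Z,
      (μ.prod circMeasure) (symmDiff (Q ⁻¹' {a}) t) < ENNReal.ofReal (1 / (n + 1)) := fun n a =>
    hdense.approx (Q ⁻¹' {a}) (hQ (measurableSet_singleton a)) (measure_ne_top _ _) _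
      Nat.one_div_pos_of_nat
  choose t ht htm using hex
  -- The approximating sets need not be disjoint, so a point is labelled by the set of indices `a`
  -- with `z ∈ t n a`, and `Q` is recoded in the same way.
  set R : ℕ → Z × Circ → Fin k → Prop := fun n z a => z ∈ t n a with hR
  set Q' : Z × Circ → Fin k → Prop := fun z a => Q z = a with hQ'def
  have hQ' : Measurable Q' := measurable_pi_lambda _ fun a =>
    measurableSet_setOfPred.1 (hQ (measurableSet_singleton a))
  have hRm : ∀ n, Measurable (R n) := fun n => measurable_pi_lambda _ fun a =>
    measurableSet_setOfPred.1 (ht n a).1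
  have hlim : Tendsto (fun n => (μ.prod circMeasure).real {z | Q' z ≠ R n z}) atTop (nhds 0) := by
    have h0 : Tendsto (fun n : ℕ => (k : ℝ) * (1 / ((n : ℝ) + 1))) atTop (nhds 0) := by
      simpa using tendsto_one_div_add_atTop_nhds_zero_nat.const_mul (k : ℝ)
    refine squeeze_zero (fun _ => measureReal_nonneg) (fun n => ?_) h0
    have hsub : {z | Q' z ≠ R n z} ⊆ ⋃ a, symmDiff (Q ⁻¹' {a}) (t n a) := by
      intro z hz
      obtain ⟨a, ha⟩ := Function.ne_iff.1 hz
      refine Set.mem_iUnion.2 ⟨a, ?_⟩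
      simp only [hQ'def, hR, ne_eq, eq_iff_iff] at ha
      rw [Set.mem_symmDiff]
      simp only [Set.mem_preimage, Set.mem_singleton_iff]
      tauto
    calc (μ.prod circMeasure).real {z | Q' z ≠ R n z}
        ≤ (μ.prod circMeasure).real (⋃ a, symmDiff (Q ⁻¹' {a}) (t n a)) := measureReal_mono hsub
      _ ≤ ∑ a, (μ.prod circMeasure).real (symmDiff (Q ⁻¹' {a}) (t n a)) :=
          measureReal_iUnion_fintype_le _
      _ ≤ ∑ _a : Fin k, (1 / ((n : ℝ) + 1)) := by
          refine Finset.sum_le_sum fun a _ => ?_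
          exact ENNReal.toReal_le_of_le_ofReal Nat.one_div_pos_of_nat.le (htm n a).le
      _ = _ := by simp
  have hcond := tendsto_condShannon hQ' hRm hlim
  have hrate : ∀ n, rate (circleExt T ω) (μ.prod circMeasure) (R n) ≤ b + Real.log 2 := by
    intro n
    choose _ q hq l P hP hdet using ht n
    have hprod : 0 < ∏ a, q a := Finset.prod_pos fun a _ => hq a
    have hPm : Measurable fun x => fun a => P a x := measurable_pi_lambda _ hP
    calc rate (circleExt T ω) (μ.prod circMeasure) (R n)
        ≤ rate (circleExt T ω) (μ.prod circMeasure)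
            (fun z => ((fun a => P a z.1), circLabel (∏ a, q a) hprod z.2)) := by
          refine rate_mono hF (hRm n) (by fun_prop) fun z z' hz => ?_
          rw [Prod.mk.injEq] at hz
          ext a
          exact hdet a z z' (congr_fun hz.1 a)
            (circLabel_of_dvd (hq a) hprod (Finset.dvd_prod_of_mem q (Finset.mem_univ a)) hz.2)
      _ ≤ _ := rate_circleExt_le hT hω hPm _ hprod
      _ ≤ b + Real.log 2 := by
          gcongr
          exact EReal.coe_le_coe_iff.1 ((rate_le_entropy hT (by fun_prop)).trans hb)
  have h1 := hcond.const_add (b + Real.log 2)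
  rw [add_zero] at h1
  refine ge_of_tendsto' h1 fun n => ?_
  calc rate (circleExt T ω) (μ.prod circMeasure) Q
      ≤ rate (circleExt T ω) (μ.prod circMeasure) Q' :=
        rate_mono hF hQ hQ' fun z z' h => by
          have := congr_fun h (Q z')
          simpa [hQ'def] using this
    _ ≤ rate (circleExt T ω) (μ.prod circMeasure) (R n) + _ :=
        rate_le_add_condShannon hF hQ' (hRm n)
    _ ≤ _ := by gcongr; exact hrate n

/-- A circle extension has the same entropy as its base. -/
theorem entropy_circleExt_le_iff (hT : MeasurePreserving T μ μ) (hω : Measurable ω) (b : ℝ) :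
    entropy (circleExt T ω) (μ.prod circMeasure) ≤ (b : EReal) ↔ entropy T μ ≤ (b : EReal) := by
  have hT' := hT.measurable
  have hF := measurePreserving_circleExt hT hω
  constructor
  · intro h
    rw [entropy_le_iff hT]
    intro k P hP
    rw [← rate_comp (T := circleExt T ω) (S := T)
      (measurePreserving_fst (μ := μ) (ν := circMeasure)) (fun _ => rfl) hT' hP]
    exact (rate_le_entropy hF (by fun_prop)).trans h
  · intro h
    -- Applying the `log 2` bound to the `n`-th iterate and dividing by `n` leaves an excess of only
    -- `log 2 / n`.
    have key : ∀ n : ℕ, 0 < n →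
        entropy (circleExt T ω) (μ.prod circMeasure) ≤ ((b + Real.log 2 / n : ℝ) : EReal) := by
      intro n hn
      have hn' : (n : ℝ) ≠ 0 := by exact_mod_cast hn.ne'
      rw [← entropy_iterate_le_iff hF hn, circleExt_iterate]
      have := entropy_circleExt_le (hT.iterate n)
        (ω := fun x => ∑ i ∈ Finset.range n, ω (T^[i] x)) (by fun_prop)
        ((entropy_iterate_le_iff hT hn b).2 h)
      rwa [show (n : ℝ) * (b + Real.log 2 / n) = n * b + Real.log 2 by field_simp]
    rw [entropy_le_iff hF]
    intro k Q hQ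
    rw [EReal.coe_le_coe_iff]
    have h1 : Tendsto (fun n : ℕ => b + Real.log 2 / (n : ℝ)) atTop (nhds (b + 0)) :=
      (tendsto_const_div_atTop_nhds_zero_nat _).const_add b
    rw [add_zero] at h1
    refine ge_of_tendsto h1 ?_
    filter_upwards [eventually_gt_atTop 0] with n hn
    exact EReal.coe_le_coe_iff.1 ((rate_le_entropy hF hQ).trans (key n hn))

end CircleExt

namespace Suspension

/-! ### Canonical representatives in the suspension -/

variable {Z : Type*} {T : Z → Z} {l : Z → ℝ} {c : ℝ}

/-- One step towards the canonical representative: cross the roof if possible. -/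
noncomputable def reduce (T : Z → Z) (l : Z → ℝ) (p : Z × ℝ≥0) : Z × ℝ≥0 :=
  if l p.1 ≤ p.2 then (T p.1, p.2 - (l p.1).toNNReal) else p

theorem reduce_of_lt {p : Z × ℝ≥0} (h : (p.2 : ℝ) < l p.1) : reduce T l p = p :=
  if_neg h.not_ge

theorem reduce_of_le {p : Z × ℝ≥0} (h : l p.1 ≤ p.2) :
    reduce T l p = (T p.1, p.2 - (l p.1).toNNReal) :=
  if_pos h

theorem coe_sub_toNNReal {a : ℝ} (ha : 0 ≤ a) {s : ℝ≥0} (h : a ≤ s) :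
    ((s - a.toNNReal : ℝ≥0) : ℝ) = s - a := by
  rw [NNReal.coe_sub (Real.toNNReal_le_iff_le_coe.2 h), Real.coe_toNNReal _ ha]

theorem reduce_snd_le (p : Z × ℝ≥0) : (reduce T l p).2 ≤ p.2 := by
  unfold reduce
  split_ifs
  · exact tsub_le_self
  · exact le_rfl

theorem mk_reduce (hl : ∀ x, 0 ≤ l x) (p : Z × ℝ≥0) :
    mk T l (reduce T l p).1 (reduce T l p).2 = mk T l p.1 p.2 := by
  rcases lt_or_ge (p.2 : ℝ) (l p.1) with h | h
  · rw [reduce_of_lt h]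
  · rw [reduce_of_le h]
    refine (Quot.sound ⟨?_, rfl⟩).symm
    simp only
    rw [coe_sub_toNNReal (hl _) h]
    ring

/-- The gluing relation is contained in the graph of `reduce`, so a `reduce`-invariant function
descends to the quotient. -/
theorem eq_reduce_of_rel (hl : ∀ x, 0 ≤ l x) {p q : Z × ℝ≥0} (h : SuspensionRel T l p q) :
    q = reduce T l p := by
  obtain ⟨h1, h2⟩ := h
  have h3 : l p.1 ≤ p.2 := by
    rw [h1]
    exact le_add_of_nonneg_right q.2.2
  rw [reduce_of_le h3]
  refine Prod.ext h2 (NNReal.coe_injective ?_)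
  simp only
  rw [coe_sub_toNNReal (hl _) h3, h1]
  ring

/-- The canonical representative of a point, if `c > 0` is a lower bound of `l`. -/
noncomputable def normalForm (T : Z → Z) (l : Z → ℝ) (c : ℝ) (p : Z × ℝ≥0) : Z × ℝ≥0 :=
  (reduce T l)^[⌊(p.2 : ℝ) / c⌋₊ + 1] p

theorem iterate_reduce_of_lt {p : Z × ℝ≥0} (h : (p.2 : ℝ) < l p.1) (n : ℕ) :
    (reduce T l)^[n] p = p :=
  Function.iterate_fixed (reduce_of_lt h) n

theorem iterate_reduce_snd_le (p : Z × ℝ≥0) (n : ℕ) : ((reduce T l)^[n] p).2 ≤ p.2 := by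
  induction n with
  | zero => exact le_rfl
  | succ n ih =>
    rw [Function.iterate_succ_apply']
    exact (reduce_snd_le _).trans ih

/-- Every crossing lowers the height by at least `c`, and `⌊s / c⌋ + 1` crossings would make it
negative. -/
theorem normalForm_lt (hc : 0 < c) (hl : ∀ x, c ≤ l x) (p : Z × ℝ≥0) :
    ((normalForm T l c p).2 : ℝ) < l (normalForm T l c p).1 := by
  have key : ∀ n : ℕ, (((reduce T l)^[n] p).2 : ℝ) < l ((reduce T l)^[n] p).1 ∨
      (((reduce T l)^[n] p).2 : ℝ) + n * c ≤ p.2 := by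
    intro n
    induction n with
    | zero => right; simp
    | succ n ih =>
      rw [Function.iterate_succ_apply']
      rcases lt_or_ge (((reduce T l)^[n] p).2 : ℝ) (l ((reduce T l)^[n] p).1) with h | h
      · left
        rwa [reduce_of_lt h]
      · right
        rw [reduce_of_le h]
        simp only
        rw [coe_sub_toNNReal (hc.le.trans (hl _)) h]
        have h1 := ih.resolve_left h.not_gt
        have h2 := hl ((reduce T l)^[n] p).1
        push_cast
        linarith
  refine (key _).resolve_right fun h => ?_
  have h1 := Nat.lt_floor_add_one ((p.2 : ℝ) / c)
  rw [div_lt_iff₀ hc] at h1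
  have h2 : (0 : ℝ) ≤ ((reduce T l)^[⌊(p.2 : ℝ) / c⌋₊ + 1] p).2 := NNReal.coe_nonneg _
  push_cast at h
  linarith

/-- Points below the roof are fixed by `reduce`, so surplus iterations do not matter. -/
theorem normalForm_eq_iterate (hc : 0 < c) (hl : ∀ x, c ≤ l x) {p : Z × ℝ≥0} {n : ℕ}
    (h : (((reduce T l)^[n] p).2 : ℝ) < l ((reduce T l)^[n] p).1) :
    normalForm T l c p = (reduce T l)^[n] p := by
  have h' := normalForm_lt (T := T) hc hl p
  unfold normalForm at h' ⊢
  generalize ⌊(p.2 : ℝ) / c⌋₊ + 1 = m at *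
  rcases le_total n m with hnm | hnm
  · obtain ⟨d, rfl⟩ := Nat.exists_eq_add_of_le' hnm
    rw [Function.iterate_add_apply, iterate_reduce_of_lt h]
  · obtain ⟨d, rfl⟩ := Nat.exists_eq_add_of_le' hnm
    rw [Function.iterate_add_apply, iterate_reduce_of_lt h']

theorem normalForm_reduce (hc : 0 < c) (hl : ∀ x, c ≤ l x) (p : Z × ℝ≥0) :
    normalForm T l c (reduce T l p) = normalForm T l c p := by
  have h := normalForm_lt (T := T) hc hl (reduce T l p)
  conv_rhs => rw [normalForm_eq_iterate hc hl (n := ⌊((reduce T l p).2 : ℝ) / c⌋₊ + 1 + 1) (by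
    rw [Function.iterate_succ_apply]; exact h)]
  rw [Function.iterate_succ_apply]
  rfl

theorem normalForm_of_lt (hc : 0 < c) (hl : ∀ x, c ≤ l x) {p : Z × ℝ≥0}
    (h : (p.2 : ℝ) < l p.1) : normalForm T l c p = p :=
  normalForm_eq_iterate hc hl (n := 0) h

theorem measurable_normalForm [MeasurableSpace Z] (hT : Measurable T) (hlm : Measurable l) :
    Measurable (normalForm T l c) := by
  have h1 : Measurable (reduce T l) := by
    unfold reduce
    refine Measurable.ite (measurableSet_le (by fun_prop) (by fun_prop)) (by fun_prop)
      measurable_id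
  have h2 : Measurable fun q : ℕ × (Z × ℝ≥0) => (reduce T l)^[q.1] q.2 :=
    measurable_from_prod_countable_right fun n => h1.iterate n
  have h3 : Measurable fun p : Z × ℝ≥0 => ⌊(p.2 : ℝ) / c⌋₊ + 1 :=
    (Nat.measurable_floor.comp (by fun_prop)).add_const 1
  exact h2.comp (h3.prodMk measurable_id)

/-- The canonical representative `(x, s)`, `0 ≤ s < l x`, of a point of the suspension. -/
noncomputable def rep (T : Z → Z) (l : Z → ℝ) {c : ℝ} (hc : 0 < c) (hl : ∀ x, c ≤ l x) :
    Suspension T l → Z × ℝ≥0 :=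
  Quot.lift (normalForm T l c) fun p q h => by
    rw [eq_reduce_of_rel (fun x => hc.le.trans (hl x)) h, normalForm_reduce hc hl]

variable (hc : 0 < c) (hl : ∀ x, c ≤ l x)

theorem rep_mk (x : Z) (s : ℝ≥0) : rep T l hc hl (mk T l x s) = normalForm T l c (x, s) := rfl

theorem rep_mk_of_lt {x : Z} {s : ℝ≥0} (h : (s : ℝ) < l x) :
    rep T l hc hl (mk T l x s) = (x, s) :=
  normalForm_of_lt hc hl h

theorem rep_lt (y : Suspension T l) :
    ((rep T l hc hl y).2 : ℝ) < l (rep T l hc hl y).1 := by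
  induction y using Quot.ind with
  | mk p => exact normalForm_lt hc hl p

theorem mk_rep (y : Suspension T l) : mk T l (rep T l hc hl y).1 (rep T l hc hl y).2 = y := by
  induction y using Quot.ind with
  | mk p =>
    have key : ∀ n : ℕ, mk T l ((reduce T l)^[n] p).1 ((reduce T l)^[n] p).2 = mk T l p.1 p.2 := by
      intro n
      induction n with
      | zero => rfl
      | succ n ih => rw [Function.iterate_succ_apply', mk_reduce fun x => hc.le.trans (hl x), ih]
    exact key _

theorem mk_of_le (hl0 : ∀ x, 0 ≤ l x) {x : Z} {s : ℝ≥0} (h : l x ≤ s) :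
    mk T l x s = mk T l (T x) (s - (l x).toNNReal) := by
  have := mk_reduce (T := T) hl0 (x, s)
  rw [reduce_of_le h] at this
  exact this.symm

theorem flow_mk (t : ℝ≥0) (x : Z) (s : ℝ≥0) : flow T l t (mk T l x s) = mk T l x (s + t) := rfl

theorem rep_flow (t : ℝ≥0) (y : Suspension T l) : rep T l hc hl (flow T l t y) =
    normalForm T l c ((rep T l hc hl y).1, (rep T l hc hl y).2 + t) := by
  conv_lhs => rw [← mk_rep hc hl y, flow_mk, rep_mk]

theorem rep_flow_of_lt {t : ℝ≥0} {y : Suspension T l}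
    (h : ((rep T l hc hl y).2 + t : ℝ) < l (rep T l hc hl y).1) :
    rep T l hc hl (flow T l t y) = ((rep T l hc hl y).1, (rep T l hc hl y).2 + t) := by
  rw [rep_flow, normalForm_of_lt hc hl (by exact_mod_cast h)]

theorem rep_flow_snd_lt {t : ℝ≥0} {y : Suspension T l}
    (h : l (rep T l hc hl y).1 ≤ (rep T l hc hl y).2 + t) :
    (rep T l hc hl (flow T l t y)).2 < t := by
  have h' : l (rep T l hc hl y).1 ≤ (((rep T l hc hl y).2 + t : ℝ≥0) : ℝ) := by exact_mod_cast h
  rw [rep_flow, ← normalForm_reduce hc hl, reduce_of_le (by exact h')]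
  refine (iterate_reduce_snd_le _ _).trans_lt ?_
  rw [← NNReal.coe_lt_coe]
  simp only
  rw [coe_sub_toNNReal (hc.le.trans (hl _)) h']
  have := rep_lt hc hl y
  push_cast
  linarith

/-- In time at most `c` the roof is crossed at most once, as the height after a crossing is below `t
≤ c`. -/
theorem rep_flow_of_le {t : ℝ≥0} (ht : (t : ℝ) ≤ c) {y : Suspension T l}
    (h : l (rep T l hc hl y).1 ≤ (rep T l hc hl y).2 + t) :
    (rep T l hc hl (flow T l t y)).1 = T (rep T l hc hl y).1 := by
  have h' : l (rep T l hc hl y).1 ≤ (((rep T l hc hl y).2 + t : ℝ≥0) : ℝ) := by exact_mod_cast h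
  rw [rep_flow, ← normalForm_reduce hc hl, reduce_of_le (by exact h'), normalForm_of_lt hc hl]
  simp only
  rw [coe_sub_toNNReal (hc.le.trans (hl _)) h']
  have := rep_lt hc hl y
  have := hl (T (rep T l hc hl y).1)
  push_cast
  linarith

section Measurable

variable [MeasurableSpace Z]

theorem measurable_mk : Measurable fun p : Z × ℝ≥0 => mk T l p.1 p.2 := measurable_quot_mk

theorem measurable_of_comp_mk {Y : Type*} [MeasurableSpace Y] {g : Suspension T l → Y}
    (h : Measurable fun p : Z × ℝ≥0 => g (mk T l p.1 p.2)) : Measurable g :=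
  fun _ hs => h hs

theorem measurable_rep (hT : Measurable T) (hlm : Measurable l) :
    Measurable (rep T l hc hl) :=
  measurable_of_comp_mk (measurable_normalForm hT hlm)

theorem measurable_flow (t : ℝ≥0) : Measurable (flow T l t) :=
  measurable_of_comp_mk <|
    measurable_mk.comp (g := fun p : Z × ℝ≥0 => mk T l p.1 p.2)
      (f := fun p : Z × ℝ≥0 => (p.1, p.2 + t)) (by fun_prop)

end Measurable

theorem flow_iterate (t : ℝ≥0) (n : ℕ) : (flow T l t)^[n] = flow T l (n * t) := by
  induction n with
  | zero =>
    ext1 y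
    induction y using Quot.ind with
    | mk p =>
      change mk T l p.1 p.2 = mk T l p.1 (p.2 + (0 : ℕ) * t)
      simp
  | succ n ih =>
    ext1 y
    rw [Function.iterate_succ_apply', ih]
    induction y using Quot.ind with
    | mk p =>
      change mk T l p.1 (p.2 + n * t + t) = mk T l p.1 (p.2 + (n + 1 : ℕ) * t)
      push_cast
      ring_nf

end Suspension

namespace Suspension

/-! ### The lifted measure and the tower structure of the flow -/

/-- Lebesgue measure of a subset of `[0, R δ)`, computed level by level. -/
theorem volume_eq_sum_circ {δ : ℝ} (hδ : 0 < δ) (R : ℕ) {D : Set ℝ} (hD : MeasurableSet D)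
    (hDR : D ⊆ Set.Ico 0 (R * δ)) :
    volume D = ENNReal.ofReal δ *
      ∑ i ∈ Finset.range R, circMeasure {u : Circ | ((u : ℝ) + i) * δ ∈ D} := by
  have hlev : ∀ i : ℕ, MeasurableSet (D ∩ {s | ⌊s / δ⌋₊ = i}) := fun i =>
    hD.inter ((Nat.measurable_floor.comp (measurable_id.div_const δ))
      (measurableSet_singleton i))
  have hcov : D = ⋃ i ∈ Finset.range R, D ∩ {s | ⌊s / δ⌋₊ = i} := by
    ext s
    simp only [Set.mem_iUnion, Finset.mem_range, Set.mem_inter_iff, Set.mem_ofPred_eq, exists_prop]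
    constructor
    · intro hs
      refine ⟨_, ?_, hs, rfl⟩
      rw [Nat.floor_lt (div_nonneg (hDR hs).1 hδ.le), div_lt_iff₀ hδ]
      exact (hDR hs).2
    · rintro ⟨i, -, hs, -⟩
      exact hs
  have hdisj : Set.PairwiseDisjoint (Finset.range R : Set ℕ)
      fun i => D ∩ {s | ⌊s / δ⌋₊ = i} := by
    intro i _ i' _ hii'
    rw [Function.onFun, Set.disjoint_left]
    rintro s ⟨-, h1⟩ ⟨-, h2⟩
    exact hii' (h1.symm.trans h2)
  conv_lhs => rw [hcov]
  rw [measure_biUnion_finset hdisj fun i _ => hlev i, Finset.mul_sum]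
  refine Finset.sum_congr rfl fun i _ => ?_
  -- On level `i` the coordinate is `s = (u + i) * δ`; the floor condition says exactly `u ∈ [0,
  -- 1)`.
  have h1 : circMeasure {u : Circ | ((u : ℝ) + i) * δ ∈ D} =
      volume ((fun u : ℝ => (u + i) * δ) ⁻¹' (D ∩ {s | ⌊s / δ⌋₊ = i})) := by
    have := measurePreserving_coe_circ.measure_preimage
      (s := (fun u : ℝ => (u + i) * δ) ⁻¹' D)
      ((by fun_prop : Measurable fun u : ℝ => (u + i) * δ) hD).nullMeasurableSet
    rw [Measure.restrict_apply ((by fun_prop : Measurable fun u : ℝ => (u + i) * δ) hD)] at this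
    refine this.trans ?_
    congr 1
    ext u
    simp only [Set.mem_inter_iff, Set.mem_preimage, Set.mem_Ico, Set.mem_ofPred_eq,
      mul_div_cancel_right₀ _ hδ.ne']
    refine and_congr_right fun hu => ?_
    have h2 : 0 ≤ u + i := by
      have := (hDR hu).1
      nlinarith
    rw [Nat.floor_eq_iff h2]
    constructor <;> rintro ⟨h3, h4⟩ <;> constructor <;> linarith
  have h2 : (fun u : ℝ => (u + i) * δ) ⁻¹' (D ∩ {s | ⌊s / δ⌋₊ = i}) =
      (fun u : ℝ => u + i) ⁻¹' ((fun u : ℝ => u * δ) ⁻¹' (D ∩ {s | ⌊s / δ⌋₊ = i})) := rfl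
  rw [h1, h2, measure_preimage_add_right, Real.volume_preimage_mul_right hδ.ne', ← mul_assoc,
    ← ENNReal.ofReal_mul hδ.le, abs_of_pos (inv_pos.2 hδ), mul_inv_cancel₀ hδ.ne',
    ENNReal.ofReal_one, one_mul]

variable {Z : Type*} [MeasurableSpace Z] {T : Z → Z} {l : Z → ℝ} {c C : ℝ}
  {μ : Measure Z} [IsProbabilityMeasure μ]

theorem integrable_roof (hlm : Measurable l) (hl : ∀ x, c ≤ l x) (hlC : ∀ x, l x ≤ C) :
    Integrable l μ :=
  Integrable.of_mem_Icc c C hlm.aemeasurable (Eventually.of_forall fun x => ⟨hl x, hlC x⟩)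

theorem le_integral_roof (hlm : Measurable l) (hl : ∀ x, c ≤ l x) (hlC : ∀ x, l x ≤ C) :
    c ≤ ∫ x, l x ∂μ := by
  have := integral_mono (μ := μ) (integrable_const c) (integrable_roof hlm hl hlC) hl
  simpa using this

theorem integral_roof_le (hlm : Measurable l) (hl : ∀ x, c ≤ l x) (hlC : ∀ x, l x ≤ C) :
    ∫ x, l x ∂μ ≤ C := by
  have := integral_mono (μ := μ) (integrable_roof hlm hl hlC) (integrable_const C) hlC
  simpa using this

theorem measurable_mk_toNNReal :
    Measurable fun p : Z × ℝ => mk T l p.1 p.2.toNNReal :=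
  measurable_mk.comp (g := fun p : Z × ℝ≥0 => mk T l p.1 p.2)
    (f := fun p : Z × ℝ => (p.1, p.2.toNNReal)) (by fun_prop)

/-- The region below the roof. -/
theorem measurableSet_region (hlm : Measurable l) :
    MeasurableSet {p : Z × ℝ | 0 ≤ p.2 ∧ p.2 < l p.1} :=
  (measurableSet_le measurable_const measurable_snd).inter
    (measurableSet_lt measurable_snd (hlm.comp measurable_fst))

theorem liftMeasure_apply (hlm : Measurable l) {E : Set (Suspension T l)} (hE : MeasurableSet E) :
    liftMeasure T l μ E = (ENNReal.ofReal (∫ x, l x ∂μ))⁻¹ *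
      ∫⁻ x, volume {s : ℝ | (0 ≤ s ∧ s < l x) ∧ mk T l x s.toNNReal ∈ E} ∂μ := by
  have hm := (measurable_mk_toNNReal (T := T) (l := l)) hE
  rw [liftMeasure, Measure.smul_apply, smul_eq_mul, Measure.map_apply measurable_mk_toNNReal hE,
    Measure.restrict_apply hm, Measure.prod_apply (hm.inter (measurableSet_region hlm))]
  congr 1
  refine lintegral_congr fun x => ?_
  congr 1
  ext s
  simp only [Set.mem_preimage, Set.mem_inter_iff, Set.mem_ofPred_eq]
  tauto

theorem isProbabilityMeasure_liftMeasure (hlm : Measurable l) (hc : 0 < c) (hl : ∀ x, c ≤ l x)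
    (hlC : ∀ x, l x ≤ C) : IsProbabilityMeasure (liftMeasure T l μ) := by
  constructor
  rw [liftMeasure_apply hlm MeasurableSet.univ]
  have h1 : ∀ x, volume {s : ℝ | (0 ≤ s ∧ s < l x) ∧ mk T l x s.toNNReal ∈ Set.univ} =
      ENNReal.ofReal (l x) := fun x => by
    have : {s : ℝ | (0 ≤ s ∧ s < l x) ∧ mk T l x s.toNNReal ∈ Set.univ} = Set.Ico 0 (l x) := by
      ext s
      simp
    rw [this, Real.volume_Ico, sub_zero]
  simp only [h1]
  rw [← ofReal_integral_eq_lintegral_ofReal (integrable_roof hlm hl hlC)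
    (Eventually.of_forall fun x => hc.le.trans (hl x))]
  refine ENNReal.inv_mul_cancel ?_ ENNReal.ofReal_ne_top
  rw [ne_eq, ENNReal.ofReal_eq_zero, not_le]
  exact hc.trans_le (le_integral_roof hlm hl hlC)

/-- The time-`δ` map of the flow, for `δ ≤ c`, is a tower over a circle extension of `T`. -/
theorem isTower_flow (hT : Measurable T) (hlm : Measurable l) (hc : 0 < c) (hl : ∀ x, c ≤ l x)
    (hlC : ∀ x, l x ≤ C) (δ : ℝ≥0) (hδ : 0 < δ) (hδc : (δ : ℝ) ≤ c) :
    IsTower (flow T l δ) (circleExt T fun x => -(l x / δ)) (liftMeasure T l μ)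
      (μ.prod circMeasure)
      (fun y => ((rep T l hc hl y).1, toCirc ((rep T l hc hl y).2 / δ)))
      (fun y => ⌊((rep T l hc hl y).2 / δ : ℝ)⌋₊)
      (fun i w => mk T l w.1 (((w.2 : ℝ) + i) * δ).toNNReal)
      (fun w => ⌈l w.1 / δ - w.2⌉₊) ⌈C / δ⌉₊
      ((ENNReal.ofReal (∫ x, l x ∂μ))⁻¹ * ENNReal.ofReal δ) := by
  have hδ' : (0 : ℝ) < δ := hδ
  have hrep := measurable_rep hc hl hT hlm
  -- The ceiling counts the levels `i ≥ 0` with `(u + i) * δ` still below the roof.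
  have hlt : ∀ (i : ℕ) (w : Z × Circ), i < ⌈l w.1 / δ - w.2⌉₊ ↔ ((w.2 : ℝ) + i) * δ < l w.1 := by
    intro i w
    rw [Nat.lt_ceil, lt_sub_iff_add_lt', lt_div_iff₀ hδ']
  have hnn : ∀ (i : ℕ) (u : Circ), 0 ≤ ((u : ℝ) + i) * δ := fun i u =>
    mul_nonneg (add_nonneg u.2.1 (Nat.cast_nonneg i)) hδ'.le
  have hcoe : ∀ (i : ℕ) (u : Circ), ((((u : ℝ) + i) * δ).toNNReal : ℝ) = ((u : ℝ) + i) * δ :=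
    fun i u => Real.coe_toNNReal _ (hnn i u)
  have hrepj : ∀ (i : ℕ) (w : Z × Circ), i < ⌈l w.1 / δ - w.2⌉₊ →
      rep T l hc hl (mk T l w.1 (((w.2 : ℝ) + i) * δ).toNNReal) =
        (w.1, (((w.2 : ℝ) + i) * δ).toNNReal) := fun i w h =>
    rep_mk_of_lt hc hl (by rw [hcoe]; exact (hlt i w).1 h)
  have hpk : ∀ s : ℝ, 0 ≤ s → ((toCirc (s / δ) : ℝ) + ⌊s / δ⌋₊) * δ = s := by
    intro s hs
    have h0 : 0 ≤ s / δ := div_nonneg hs hδ'.le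
    simp only [toCirc]
    rw [natCast_floor_eq_intCast_floor h0, Int.fract_add_floor, div_mul_cancel₀ _ hδ'.ne']
  refine ⟨measurable_flow δ, ?_, ?_, ?_, ?_, ?_, ?_, ?_, ?_, ?_, ?_, ?_, ?_, ?_⟩
  · exact (measurable_fst.comp hrep).prodMk (measurable_toCirc.comp (by fun_prop))
  · exact Nat.measurable_floor.comp (by fun_prop)
  · intro i
    exact measurable_mk_toNNReal.comp (f := fun w : Z × Circ => (w.1, ((w.2 : ℝ) + i) * δ))
      (by fun_prop)
  · exact Nat.measurable_ceil.comp (by fun_prop)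
  · intro w
    rw [hlt]
    have h1 : (w.2 : ℝ) * δ < δ := mul_lt_of_lt_one_left hδ' w.2.2.2
    have := hl w.1
    push_cast
    linarith
  · intro w
    refine Nat.ceil_le_ceil ?_
    have h1 : l w.1 / δ ≤ C / δ := by gcongr; exact hlC _
    have := w.2.2.1
    linarith
  · intro y
    rw [hlt, hpk _ (NNReal.coe_nonneg _)]
    exact rep_lt hc hl y
  · intro y
    simp only
    rw [hpk _ (NNReal.coe_nonneg _), Real.toNNReal_coe, mk_rep]
  · intro i w h
    rw [hrepj i w h, hcoe, mul_div_cancel_right₀ _ hδ'.ne']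
    refine Prod.ext rfl (Subtype.ext ?_)
    simp only [toCirc, Int.fract_add_natCast]
    exact Int.fract_eq_self.2 w.2.2
  · intro i w h
    rw [hrepj i w h, hcoe, mul_div_cancel_right₀ _ hδ'.ne', Nat.floor_add_natCast w.2.2.1,
      Nat.floor_eq_zero.2 w.2.2.2, zero_add]
  · intro i w _
    simp only [flow_mk]
    congr 1
    refine NNReal.coe_injective ?_
    rw [NNReal.coe_add, hcoe, hcoe]
    push_cast
    ring
  · intro i w h
    have h1 : ((w.2 : ℝ) + i) * δ < l w.1 := (hlt i w).1 (by omega)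
    have h2 : l w.1 ≤ ((w.2 : ℝ) + i) * δ + δ := by
      have : ¬ (i + 1 < ⌈l w.1 / δ - w.2⌉₊) := by omega
      rw [hlt] at this
      push_cast at this
      linarith
    have h3 : l w.1 ≤ (((((w.2 : ℝ) + i) * δ).toNNReal + δ : ℝ≥0) : ℝ) := by
      rw [NNReal.coe_add, hcoe]
      exact h2
    simp only [flow_mk]
    rw [mk_of_le (fun x => hc.le.trans (hl x)) h3]
    simp only [circleExt]
    congr 1
    refine NNReal.coe_injective ?_
    rw [coe_sub_toNNReal (hc.le.trans (hl _)) h3, NNReal.coe_add, hcoe, hcoe]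
    -- After the crossing the height is `(u + i + 1) δ - l`, in `[0, δ)`. Divided by `δ` it differs
    -- from `u - l / δ` by an integer, hence is its fractional part.
    have h4 : (toCirc ((w.2 : ℝ) + -(l w.1 / δ)) : ℝ) = w.2 + -(l w.1 / δ) + (i + 1 : ℕ) := by
      simp only [toCirc]
      rw [← Int.fract_add_natCast _ (i + 1), Int.fract_eq_self]
      have e : ((w.2 : ℝ) + -(l w.1 / δ) + (i + 1 : ℕ)) =
          (((w.2 : ℝ) + i) * δ + δ - l w.1) / δ := by
        push_cast
        field_simp
        ring
      rw [e]
      exact ⟨div_nonneg (by linarith) hδ'.le, (div_lt_one hδ').2 (by linarith)⟩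
    rw [h4]
    push_cast
    field_simp
    ring
  · intro E hE
    have hmk := (measurable_mk_toNNReal (T := T) (l := l)) hE
    rw [liftMeasure_apply hlm hE, mul_assoc]
    congr 1
    have hm : ∀ i : ℕ, MeasurableSet {w : Z × Circ | i < ⌈l w.1 / δ - w.2⌉₊ ∧
        mk T l w.1 (((w.2 : ℝ) + i) * δ).toNNReal ∈ E} := fun i =>
      (measurableSet_lt measurable_const (Nat.measurable_ceil.comp (by fun_prop))).inter
        ((measurable_mk_toNNReal.comp (f := fun w : Z × Circ => (w.1, ((w.2 : ℝ) + i) * δ))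
          (by fun_prop)) hE)
    have hslice : ∀ x, volume {s : ℝ | (0 ≤ s ∧ s < l x) ∧ mk T l x s.toNNReal ∈ E} =
        ENNReal.ofReal δ * ∑ i ∈ Finset.range ⌈C / δ⌉₊, circMeasure (Prod.mk x ⁻¹'
          {w : Z × Circ | i < ⌈l w.1 / δ - w.2⌉₊ ∧
            mk T l w.1 (((w.2 : ℝ) + i) * δ).toNNReal ∈ E}) := by
      intro x
      rw [volume_eq_sum_circ hδ' ⌈C / δ⌉₊]
      · congr 1
        refine Finset.sum_congr rfl fun i _ => ?_
        congr 1
        ext u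
        have := hlt i (x, u)
        simp only [Set.mem_ofPred_eq, Set.mem_preimage] at this ⊢
        rw [this]
        have := hnn i u
        tauto
      · exact ((measurableSet_region hlm).inter hmk).preimage measurable_prodMk_left
      · rintro s ⟨⟨h1, h2⟩, -⟩
        refine ⟨h1, h2.trans_le ((hlC x).trans ?_)⟩
        rw [← div_le_iff₀ hδ']
        exact Nat.le_ceil _
    simp only [hslice]
    rw [lintegral_const_mul _ (Finset.measurable_fun_sum _ fun i _ =>
      measurable_measure_prodMk_left (hm i))]
    congr 1
    rw [lintegral_finsetSum _ fun i _ => measurable_measure_prodMk_left (hm i)]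
    refine Finset.sum_congr rfl fun i _ => ?_
    rw [Measure.prod_apply (hm i)]

theorem toReal_tower_factor {L : ℝ} (hL : 0 < L) (δ : ℝ≥0) :
    ((ENNReal.ofReal L)⁻¹ * ENNReal.ofReal δ).toReal = δ / L := by
  rw [ENNReal.toReal_mul, ENNReal.toReal_inv, ENNReal.toReal_ofReal hL.le,
    ENNReal.toReal_ofReal (NNReal.coe_nonneg δ), div_eq_inv_mul]

/-- Positive times up to `c` are covered by the tower; a longer time `t` is an iterate of time `t /
n ≤ c`. -/
theorem isFlowInvariantProb_liftMeasure (hlm : Measurable l) (hc : 0 < c) (hl : ∀ x, c ≤ l x)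
    (hlC : ∀ x, l x ≤ C) (hTμ : MeasurePreserving T μ μ) :
    IsFlowInvariantProb (flow T l) (liftMeasure T l μ) := by
  have hsmall : ∀ δ : ℝ≥0, 0 < δ → (δ : ℝ) ≤ c →
      MeasurePreserving (flow T l δ) (liftMeasure T l μ) (liftMeasure T l μ) := fun δ h1 h2 =>
    (isTower_flow hTμ.measurable hlm hc hl hlC δ h1 h2).measurePreserving
      (measurePreserving_circleExt hTμ (by fun_prop))
  refine ⟨isProbabilityMeasure_liftMeasure hlm hc hl hlC, fun t => ?_⟩
  rcases eq_or_ne t 0 with rfl | ht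
  · have : flow T l 0 = id := by
      simpa using (flow_iterate (T := T) (l := l) 1 0).symm
    rw [this]
    exact MeasurePreserving.id _
  · obtain ⟨n, hn⟩ := exists_nat_gt ((t : ℝ) / c)
    have ht' : (0 : ℝ) < t := by positivity
    have hn0 : (0 : ℝ) < n := (div_pos ht' hc).trans hn
    have hn1 : (n : ℝ≥0) ≠ 0 := by
      have : (n : ℝ) ≠ 0 := hn0.ne'
      exact_mod_cast this
    have h := (hsmall (t / n) (by positivity) (by
      rw [div_lt_iff₀ hc] at hn
      push_cast
      rw [div_le_iff₀ hn0]
      linarith)).iterate n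
    rwa [flow_iterate, mul_div_cancel₀ _ hn1] at h

/-- Abramov's formula for the suspension flow. -/
theorem entropy_flow_le_iff (hlm : Measurable l) (hc : 0 < c) (hl : ∀ x, c ≤ l x)
    (hlC : ∀ x, l x ≤ C) (hTμ : MeasurePreserving T μ μ) (b : ℝ) :
    entropy (flow T l 1) (liftMeasure T l μ) ≤ ((b / ∫ x, l x ∂μ : ℝ) : EReal) ↔
      entropy T μ ≤ (b : EReal) := by
  -- Ensures `1 / n ≤ c`, so that the time-one map is the `n`-th iterate of a tower map.
  obtain ⟨n, hn⟩ := exists_nat_gt (1 / c)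
  have hn0 : (0 : ℝ) < n := (div_pos one_pos hc).trans hn
  have hn0' : 0 < n := by exact_mod_cast hn0
  have hn1 : (n : ℝ≥0) ≠ 0 := by exact_mod_cast hn0'.ne'
  have hL : 0 < ∫ x, l x ∂μ := hc.trans_le (le_integral_roof hlm hl hlC)
  have hδ : (((1 / n : ℝ≥0) : ℝ)) ≤ c := by
    rw [div_lt_iff₀ hc] at hn
    push_cast
    rw [div_le_iff₀ hn0]
    linarith
  have hinv := isFlowInvariantProb_liftMeasure hlm hc hl hlC hTμ
  have := hinv.1
  have h1 := entropy_iterate_le_iff (hinv.2 (1 / n)) hn0' ((1 / n) / (∫ x, l x ∂μ) * b)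
  have htow := isTower_flow (μ := μ) hTμ.measurable hlm hc hl hlC (1 / n) (by positivity) hδ
  have h2 := htow.entropy_le_iff (measurePreserving_circleExt hTμ (by fun_prop))
    (by rw [toReal_tower_factor hL]; positivity) b
  rw [toReal_tower_factor hL] at h2
  rw [flow_iterate, mul_one_div_cancel hn1] at h1
  rw [entropy_circleExt_le_iff hTμ (by fun_prop)] at h2
  rw [← h2, show b / ∫ x, l x ∂μ = n * ((1 / n) / (∫ x, l x ∂μ) * b) by field_simp, h1]
  push_cast
  rfl

end Suspension

namespace Suspension

/-! ### Flow-invariant measures are lifted measures -/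

variable {Z : Type*} [MeasurableSpace Z] {T : Z → Z} {l : Z → ℝ} {c C : ℝ}

/-- Test invariance at time `c` on the collar `A × [0, c)`. Its preimage is the strip of width `c`
below the roof over `T ⁻¹' A`; comparing masses gives `μ (T ⁻¹' A) = μ A`. -/
theorem measurePreserving_of_liftMeasure {μ : Measure Z} [IsProbabilityMeasure μ]
    (hT : Measurable T) (hlm : Measurable l) (hc : 0 < c) (hl : ∀ x, c ≤ l x)
    (hlC : ∀ x, l x ≤ C) (h : IsFlowInvariantProb (flow T l) (liftMeasure T l μ)) :
    MeasurePreserving T μ μ := by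
  refine ⟨hT, ?_⟩
  ext A hA
  rw [Measure.map_apply hT hA]
  obtain ⟨δ, hδ⟩ : ∃ δ : ℝ≥0, (δ : ℝ) = c := ⟨⟨c, hc.le⟩, rfl⟩
  have hrep := measurable_rep hc hl hT hlm
  have hsm : Measurable fun y => ((rep T l hc hl y).2 : ℝ) :=
    (measurable_snd.comp hrep).coe_nnreal_real
  set E : Set (Suspension T l) :=
    {y | (rep T l hc hl y).1 ∈ A ∧ ((rep T l hc hl y).2 : ℝ) < c} with hE
  have hEm : MeasurableSet E :=
    (measurable_fst.comp hrep hA).inter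
      (measurableSet_lt hsm measurable_const)
  have h1 := (h.2 δ).measure_preimage hEm.nullMeasurableSet
  rw [liftMeasure_apply hlm hEm, liftMeasure_apply hlm (measurable_flow δ hEm)] at h1
  have hL : 0 < ∫ x, l x ∂μ := hc.trans_le (le_integral_roof hlm hl hlC)
  rw [ENNReal.mul_right_inj (by simp) (by simpa using hL)] at h1
  have hrepx : ∀ (x : Z) (s : ℝ), 0 ≤ s → s < l x →
      rep T l hc hl (mk T l x s.toNNReal) = (x, s.toNNReal) := fun x s h0 h1 =>
    rep_mk_of_lt hc hl (by rwa [Real.coe_toNNReal _ h0])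
  have e1 : ∀ x, volume {s : ℝ | (0 ≤ s ∧ s < l x) ∧ mk T l x s.toNNReal ∈ E} =
      A.indicator (fun _ => ENNReal.ofReal c) x := by
    intro x
    have hcx := hl x
    by_cases hx : x ∈ A
    · rw [Set.indicator_of_mem hx]
      have : {s : ℝ | (0 ≤ s ∧ s < l x) ∧ mk T l x s.toNNReal ∈ E} = Set.Ico 0 c := by
        ext s
        simp only [Set.mem_ofPred_eq, Set.mem_Ico, hE]
        constructor
        · rintro ⟨⟨h0, h1⟩, -, h2⟩
          rw [hrepx x s h0 h1, Real.coe_toNNReal _ h0] at h2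
          exact ⟨h0, h2⟩
        · rintro ⟨h0, h1⟩
          rw [hrepx x s h0 (h1.trans_le hcx), Real.coe_toNNReal _ h0]
          exact ⟨⟨h0, h1.trans_le hcx⟩, hx, h1⟩
      rw [this, Real.volume_Ico, sub_zero]
    · rw [Set.indicator_of_notMem hx]
      convert measure_empty (μ := (volume : Measure ℝ))
      rw [Set.eq_empty_iff_forall_notMem]
      rintro s ⟨⟨h0, h1⟩, h2, -⟩
      rw [hrepx x s h0 h1] at h2
      exact hx h2
  have e2 : ∀ x, volume {s : ℝ | (0 ≤ s ∧ s < l x) ∧ mk T l x s.toNNReal ∈ flow T l δ ⁻¹' E} =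
      (T ⁻¹' A).indicator (fun _ => ENNReal.ofReal c) x := by
    intro x
    have hcx := hl x
    have key : ∀ s : ℝ, 0 ≤ s → s < l x →
        (mk T l x s.toNNReal ∈ flow T l δ ⁻¹' E ↔ l x - c ≤ s ∧ T x ∈ A) := by
      intro s h0 h1
      have hr := hrepx x s h0 h1
      rcases lt_or_ge (s + c) (l x) with h2 | h2
      · have h3 := rep_flow_of_lt hc hl (t := δ) (y := mk T l x s.toNNReal) (by
          rw [hr, Real.coe_toNNReal _ h0, hδ]; exact h2)
        rw [hr] at h3
        simp only [hE, Set.mem_preimage, Set.mem_ofPred_eq, h3]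
        rw [NNReal.coe_add, hδ, Real.coe_toNNReal _ h0]
        constructor
        · rintro ⟨-, h4⟩
          linarith
        · rintro ⟨h4, -⟩
          linarith
      · have h3 : l (rep T l hc hl (mk T l x s.toNNReal)).1 ≤
            (rep T l hc hl (mk T l x s.toNNReal)).2 + δ := by
          rw [hr, Real.coe_toNNReal _ h0, hδ]
          exact h2
        have h4 := rep_flow_of_le hc hl hδ.le h3
        have h5 := rep_flow_snd_lt hc hl h3
        rw [← NNReal.coe_lt_coe, hδ] at h5
        rw [hr] at h4
        simp only [hE, Set.mem_preimage, Set.mem_ofPred_eq, h4]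
        have : l x - c ≤ s := by linarith
        tauto
    by_cases hx : T x ∈ A
    · rw [Set.indicator_of_mem (show x ∈ T ⁻¹' A from hx)]
      have : {s : ℝ | (0 ≤ s ∧ s < l x) ∧ mk T l x s.toNNReal ∈ flow T l δ ⁻¹' E} =
          Set.Ico (l x - c) (l x) := by
        ext s
        simp only [Set.mem_ofPred_eq, Set.mem_Ico]
        constructor
        · rintro ⟨⟨h0, h1⟩, h2⟩
          exact ⟨((key s h0 h1).1 h2).1, h1⟩
        · rintro ⟨h0, h1⟩
          have h2 : 0 ≤ s := by linarith
          exact ⟨⟨h2, h1⟩, (key s h2 h1).2 ⟨h0, hx⟩⟩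
      rw [this, Real.volume_Ico, sub_sub_cancel]
    · rw [Set.indicator_of_notMem (show x ∉ T ⁻¹' A from hx)]
      convert measure_empty (μ := (volume : Measure ℝ))
      rw [Set.eq_empty_iff_forall_notMem]
      rintro s ⟨⟨h0, h1⟩, h2⟩
      exact hx ((key s h0 h1).1 h2).2
  simp only [e1, e2] at h1
  rw [lintegral_indicator_const (hT hA), lintegral_indicator_const hA,
    ENNReal.mul_right_inj (by simpa using hc) ENNReal.ofReal_ne_top] at h1
  exact h1

/-- The flow translates an invariant measure along the fibres. -/
theorem lintegral_translate {m : Measure (Suspension T l)} (hT : Measurable T)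
    (hlm : Measurable l) (hc : 0 < c) (hl : ∀ x, c ≤ l x) {t : ℝ≥0}
    (h : MeasurePreserving (flow T l t) m m) {g : Z × ℝ → ℝ≥0∞} (hg : Measurable g) :
    ∫⁻ y, {q : Z × ℝ | (t : ℝ) ≤ q.2}.indicator g
        ((rep T l hc hl y).1, ((rep T l hc hl y).2 : ℝ)) ∂m =
      ∫⁻ y, {q : Z × ℝ | q.2 < l q.1}.indicator g
        ((rep T l hc hl y).1, ((rep T l hc hl y).2 + t : ℝ)) ∂m := by
  have hrep := measurable_rep hc hl hT hlm
  have hgm : Measurable ({q : Z × ℝ | (t : ℝ) ≤ q.2}.indicator g) :=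
    hg.indicator (measurableSet_le measurable_const measurable_snd)
  rw [← h.lintegral_comp (by fun_prop)]
  refine lintegral_congr fun y => ?_
  rcases lt_or_ge ((rep T l hc hl y).2 + t : ℝ) (l (rep T l hc hl y).1) with h1 | h1
  · rw [rep_flow_of_lt hc hl h1]
    rw [Set.indicator_of_mem, Set.indicator_of_mem]
    · rw [NNReal.coe_add]
    · exact h1
    · exact (NNReal.coe_add _ _).symm ▸ le_add_of_nonneg_left (NNReal.coe_nonneg _)
  · have h2 := rep_flow_snd_lt hc hl h1
    rw [← NNReal.coe_lt_coe] at h2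
    simp only [Set.indicator, Set.mem_ofPred_eq, h1.not_gt, h2.not_ge, if_false]

/-- Invariance under translation by a real `t` of either sign, within fibres. The window of width
`c` confines one endpoint to the collar `s < c`, which lies below the roof, so backward translation
is also legitimate. -/
theorem lintegral_window {m : Measure (Suspension T l)} (hT : Measurable T)
    (hlm : Measurable l) (hc : 0 < c) (hl : ∀ x, c ≤ l x)
    (h : IsFlowInvariantProb (flow T l) m) {g : Z × ℝ → ℝ≥0∞} (hg : Measurable g) (t : ℝ) :
    ∫⁻ y, {q : Z × ℝ | 0 ≤ q.2 - t ∧ q.2 - t < c}.indicator g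
        ((rep T l hc hl y).1, ((rep T l hc hl y).2 : ℝ)) ∂m =
      ∫⁻ y, {q : Z × ℝ | q.2 - t < c ∧ 0 ≤ q.2 ∧ q.2 < l q.1}.indicator g
        ((rep T l hc hl y).1, ((rep T l hc hl y).2 + t : ℝ)) ∂m := by
  rcases le_total 0 t with ht | ht
  · obtain ⟨t, rfl⟩ : ∃ t' : ℝ≥0, (t' : ℝ) = t := ⟨⟨t, ht⟩, rfl⟩
    have hm : MeasurableSet {q : Z × ℝ | q.2 - (t : ℝ) < c} :=
      measurableSet_lt (by fun_prop) measurable_const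
    have := lintegral_translate hT hlm hc hl (h.2 t) (hg.indicator hm)
    convert this using 3 with y y
    · simp only [Set.indicator, Set.mem_ofPred_eq, sub_nonneg]
      split_ifs <;> first | rfl | tauto
    · have h0 : (0 : ℝ) ≤ (rep T l hc hl y).2 + t :=
        add_nonneg (NNReal.coe_nonneg _) (NNReal.coe_nonneg _)
      simp only [Set.indicator, Set.mem_ofPred_eq]
      split_ifs <;> first | rfl | tauto
  · obtain ⟨τ, hτ⟩ : ∃ τ : ℝ≥0, (τ : ℝ) = -t := ⟨⟨-t, by linarith⟩, rfl⟩
    obtain rfl : t = -τ := by rw [hτ, neg_neg]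
    have hm : MeasurableSet {q : Z × ℝ | q.2 < c} :=
      measurableSet_lt measurable_snd measurable_const
    have := lintegral_translate hT hlm hc hl (h.2 τ) (g := fun q =>
      {q : Z × ℝ | q.2 < c}.indicator (fun q => g (q.1, q.2 - τ)) q)
      ((hg.comp (by fun_prop)).indicator hm)
    convert this.symm using 3 with y y
    · have h0 : (0 : ℝ) ≤ (rep T l hc hl y).2 + τ :=
        add_nonneg (NNReal.coe_nonneg _) (NNReal.coe_nonneg _)
      have h1 := hl (rep T l hc hl y).1
      simp only [Set.indicator, Set.mem_ofPred_eq, sub_neg_eq_add, add_sub_cancel_right]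
      split_ifs <;> first | rfl | (exfalso; grind)
    · have h1 := rep_lt hc hl y
      have h2 : (0 : ℝ) ≤ τ := NNReal.coe_nonneg _
      simp only [Set.indicator, Set.mem_ofPred_eq, sub_neg_eq_add,
        ← sub_eq_add_neg, sub_add_cancel, sub_nonneg]
      split_ifs <;> first | rfl | (exfalso; grind)

/-- Integrate `lintegral_window` over all real `t` and use Tonelli. On the left each point of `E` is
counted for a set of `t` of length `c`; on the right each point of the collar sweeps out its whole
fibre with Lebesgue measure. -/
theorem measure_eq_lintegral_base {m : Measure (Suspension T l)} (hT : Measurable T)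
    (hlm : Measurable l) (hc : 0 < c) (hl : ∀ x, c ≤ l x)
    (h : IsFlowInvariantProb (flow T l) m) {E : Set (Suspension T l)} (hE : MeasurableSet E) :
    ENNReal.ofReal c * m E =
      ∫⁻ x, volume {s : ℝ | (0 ≤ s ∧ s < l x) ∧ mk T l x s.toNNReal ∈ E}
        ∂((m.restrict {y | ((rep T l hc hl y).2 : ℝ) < c}).map fun y => (rep T l hc hl y).1) := by
  have := h.1
  have hrep := measurable_rep hc hl hT hlm
  have hmk := (measurable_mk_toNNReal (T := T) (l := l)) hE
  set D : Set (Z × ℝ) := {p | mk T l p.1 p.2.toNNReal ∈ E} with hD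
  have hDm : MeasurableSet D := hmk
  have hg : Measurable (D.indicator (1 : Z × ℝ → ℝ≥0∞)) := measurable_one.indicator hDm
  have hV : MeasurableSet {q : Z × ℝ | (0 ≤ q.2 ∧ q.2 < l q.1) ∧ q ∈ D} :=
    (measurableSet_region hlm).inter hDm
  have hsm : Measurable fun y => ((rep T l hc hl y).2 : ℝ) :=
    (measurable_snd.comp hrep).coe_nnreal_real
  have hxm : Measurable fun y => (rep T l hc hl y).1 := measurable_fst.comp hrep
  have hVm : Measurable fun x => volume {s : ℝ | (0 ≤ s ∧ s < l x) ∧ mk T l x s.toNNReal ∈ E} :=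
    measurable_measure_prodMk_left hV
  have hA : Measurable (Function.uncurry fun (t : ℝ) (y : Suspension T l) =>
      {q : Z × ℝ | 0 ≤ q.2 - t ∧ q.2 - t < c}.indicator (D.indicator (1 : Z × ℝ → ℝ≥0∞))
        ((rep T l hc hl y).1, ((rep T l hc hl y).2 : ℝ))) := by
    have hs' : Measurable fun p : ℝ × Suspension T l => ((rep T l hc hl p.2).2 : ℝ) - p.1 :=
      (hsm.comp measurable_snd).sub measurable_fst
    exact (hg.comp ((hxm.comp measurable_snd).prodMk (hsm.comp measurable_snd))).indicator
      ((measurableSet_le measurable_const hs').inter (measurableSet_lt hs' measurable_const))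
  have hB : Measurable (Function.uncurry fun (t : ℝ) (y : Suspension T l) =>
      {q : Z × ℝ | q.2 - t < c ∧ 0 ≤ q.2 ∧ q.2 < l q.1}.indicator
        (D.indicator (1 : Z × ℝ → ℝ≥0∞))
        ((rep T l hc hl y).1, ((rep T l hc hl y).2 + t : ℝ))) := by
    have hs' : Measurable fun p : ℝ × Suspension T l => ((rep T l hc hl p.2).2 : ℝ) + p.1 :=
      (hsm.comp measurable_snd).add measurable_fst
    exact (hg.comp ((hxm.comp measurable_snd).prodMk hs')).indicator
      ((measurableSet_lt (hs'.sub measurable_fst) measurable_const).inter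
        ((measurableSet_le measurable_const hs').inter
          (measurableSet_lt hs' (hlm.comp (hxm.comp measurable_snd)))))
  have h1 := lintegral_congr (μ := (volume : Measure ℝ)) fun t =>
    lintegral_window hT hlm hc hl h hg t
  replace h1 := (lintegral_lintegral_swap hA.aemeasurable).symm.trans
    (h1.trans (lintegral_lintegral_swap hB.aemeasurable))
  have hS : MeasurableSet {y | ((rep T l hc hl y).2 : ℝ) < c} :=
    measurableSet_lt hsm measurable_const
  rw [lintegral_map hVm hxm, ← lintegral_indicator hS]
  have eL : ∀ y, ∫⁻ t : ℝ, {q : Z × ℝ | 0 ≤ q.2 - t ∧ q.2 - t < c}.indicator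
      (D.indicator (1 : Z × ℝ → ℝ≥0∞)) ((rep T l hc hl y).1, ((rep T l hc hl y).2 : ℝ)) =
      E.indicator (fun _ => ENNReal.ofReal c) y := by
    intro y
    have hy : ((rep T l hc hl y).1, ((rep T l hc hl y).2 : ℝ)) ∈ D ↔ y ∈ E := by
      simp only [hD, Set.mem_ofPred_eq, Real.toNNReal_coe, mk_rep]
    by_cases hyE : y ∈ E
    · rw [Set.indicator_of_mem hyE]
      have : ∀ t : ℝ, {q : Z × ℝ | 0 ≤ q.2 - t ∧ q.2 - t < c}.indicator
          (D.indicator (1 : Z × ℝ → ℝ≥0∞)) ((rep T l hc hl y).1, ((rep T l hc hl y).2 : ℝ)) =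
          (Set.Ioc ((rep T l hc hl y).2 - c : ℝ) (rep T l hc hl y).2).indicator 1 t := by
        intro t
        simp only [Set.indicator, Set.mem_ofPred_eq, hy.2 hyE, Set.mem_Ioc, if_true,
          Pi.one_apply]
        refine if_congr ?_ rfl rfl
        constructor <;> rintro ⟨h1, h2⟩ <;> constructor <;> linarith
      simp only [this]
      rw [lintegral_indicator_one measurableSet_Ioc, Real.volume_Ioc, sub_sub_cancel]
    · rw [Set.indicator_of_notMem hyE]
      have hy' := mt hy.1 hyE
      simp [Set.indicator, hy']
  have eR : ∀ y, ∫⁻ t : ℝ, {q : Z × ℝ | q.2 - t < c ∧ 0 ≤ q.2 ∧ q.2 < l q.1}.indicator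
      (D.indicator (1 : Z × ℝ → ℝ≥0∞)) ((rep T l hc hl y).1, ((rep T l hc hl y).2 + t : ℝ)) =
      {y | ((rep T l hc hl y).2 : ℝ) < c}.indicator (fun y => volume {s : ℝ |
        (0 ≤ s ∧ s < l (rep T l hc hl y).1) ∧ mk T l (rep T l hc hl y).1 s.toNNReal ∈ E}) y := by
    intro y
    have hVy : MeasurableSet {s : ℝ | (0 ≤ s ∧ s < l (rep T l hc hl y).1) ∧
        mk T l (rep T l hc hl y).1 s.toNNReal ∈ E} := hV.preimage measurable_prodMk_left
    rcases lt_or_ge ((rep T l hc hl y).2 : ℝ) c with h2 | h2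
    · rw [Set.indicator_of_mem (by exact h2)]
      conv_rhs => rw [← lintegral_indicator_one hVy,
        ← lintegral_add_left_eq_self _ ((rep T l hc hl y).2 : ℝ)]
      refine lintegral_congr fun t => ?_
      simp only [Set.indicator, Set.mem_ofPred_eq, hD, add_sub_cancel_right, Pi.one_apply, h2,
        true_and]
      rw [← ite_and]
      congr 1
    · rw [Set.indicator_of_notMem (by exact h2.not_gt)]
      simp [Set.indicator, h2.not_gt]
  simp only [eL, eR] at h1
  rw [lintegral_indicator_const hE] at h1
  exact h1

/-- Every flow-invariant probability measure is the lift of an invariant probability measure of the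
base. -/
theorem exists_eq_liftMeasure {m : Measure (Suspension T l)} (hT : Measurable T)
    (hlm : Measurable l) (hc : 0 < c) (hl : ∀ x, c ≤ l x) (hlC : ∀ x, l x ≤ C)
    (h : IsFlowInvariantProb (flow T l) m) :
    ∃ μ : Measure Z, IsInvariantProb T μ ∧ m = liftMeasure T l μ := by
  have hm := h.1
  have hrep := measurable_rep hc hl hT hlm
  set κ := (m.restrict {y | ((rep T l hc hl y).2 : ℝ) < c}).map fun y => (rep T l hc hl y).1
    with hκ
  have key : ∀ E : Set (Suspension T l), MeasurableSet E → ENNReal.ofReal c * m E =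
      ∫⁻ x, volume {s : ℝ | (0 ≤ s ∧ s < l x) ∧ mk T l x s.toNNReal ∈ E} ∂κ := fun E hE =>
    measure_eq_lintegral_base hT hlm hc hl h hE
  have huniv := key Set.univ MeasurableSet.univ
  have h1 : ∀ x, volume {s : ℝ | (0 ≤ s ∧ s < l x) ∧ mk T l x s.toNNReal ∈ Set.univ} =
      ENNReal.ofReal (l x) := fun x => by
    have : {s : ℝ | (0 ≤ s ∧ s < l x) ∧ mk T l x s.toNNReal ∈ Set.univ} = Set.Ico 0 (l x) := by
      ext s
      simp
    rw [this, Real.volume_Ico, sub_zero]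
  simp only [h1, measure_univ, mul_one] at huniv
  have hκ0 : κ Set.univ ≠ 0 := by
    intro h0
    rw [Measure.measure_univ_eq_zero] at h0
    rw [h0, lintegral_zero_measure, ENNReal.ofReal_eq_zero] at huniv
    linarith
  have hκt : κ Set.univ ≠ ∞ := measure_ne_top _ _
  set μ : Measure Z := (κ Set.univ)⁻¹ • κ with hμ
  have hμp : IsProbabilityMeasure μ :=
    ⟨by rw [hμ, Measure.smul_apply, smul_eq_mul, ENNReal.inv_mul_cancel hκ0 hκt]⟩
  -- Taking `E` to be the whole space gives `∫ l dκ = c`, which fixes the normalization of the lift.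
  have hL : ENNReal.ofReal (∫ x, l x ∂μ) = (κ Set.univ)⁻¹ * ENNReal.ofReal c := by
    rw [ofReal_integral_eq_lintegral_ofReal (integrable_roof hlm hl hlC)
      (Eventually.of_forall fun x => hc.le.trans (hl x)), hμ, lintegral_smul_measure, ← huniv,
      smul_eq_mul]
  have hm_eq : m = liftMeasure T l μ := by
    ext E hE
    rw [liftMeasure_apply hlm hE, hL, hμ, lintegral_smul_measure, ← key E hE, smul_eq_mul,
      ← mul_assoc (κ Set.univ)⁻¹, ← mul_assoc, ENNReal.inv_mul_cancel, one_mul]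
    · exact mul_ne_zero (ENNReal.inv_ne_zero.2 hκt) (by simpa using hc)
    · exact ENNReal.mul_ne_top (ENNReal.inv_ne_top.2 hκ0) ENNReal.ofReal_ne_top
  refine ⟨μ, ⟨hμp, ?_⟩, hm_eq⟩
  rw [hm_eq] at h
  exact measurePreserving_of_liftMeasure hT hlm hc hl hlC h

end Suspension

/-! ### Comparison of the pressures -/

/-- Lower bounds are recovered from failing upper bounds, since the entropy formulas compare with
real upper bounds only. -/
theorem coe_le_iff_forall_lt {x : EReal} {a : ℝ} :
    (a : EReal) ≤ x ↔ ∀ d : ℝ, d < a → ¬ x ≤ (d : EReal) := by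
  constructor
  · intro h d hd hx
    exact absurd (EReal.coe_le_coe_iff.1 (h.trans hx)) hd.not_ge
  · intro h
    by_contra hx
    obtain ⟨d, h1, h2⟩ := EReal.lt_iff_exists_real_btwn.1 (not_le.1 hx)
    exact h d (EReal.coe_lt_coe_iff.1 h2) h1.le

theorem add_coe_le_coe_iff {x : EReal} {a d : ℝ} :
    x + (a : EReal) ≤ (d : EReal) ↔ x ≤ ((d - a : ℝ) : EReal) := by
  induction x using EReal.rec with
  | bot => simp
  | top => rw [EReal.top_add_coe, top_le_iff, top_le_iff]; simp only [EReal.coe_ne_top]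
  | coe x =>
    rw [← EReal.coe_add, EReal.coe_le_coe_iff, EReal.coe_le_coe_iff, le_sub_iff_add_le]

theorem isEquilibrium_iff {X : Type*} [MeasurableSpace X] {T : X → X} {g : X → ℝ}
    {μ : Measure X} : IsEquilibrium T g μ ↔ IsInvariantProb T μ ∧
      pressure T g ≤ entropy T μ + ((∫ x, g x ∂μ : ℝ) : EReal) := by
  rw [IsEquilibrium, pressure, iSup₂_le_iff]

theorem isFlowEquilibrium_iff {X : Type*} [MeasurableSpace X] {φ : ℝ≥0 → X → X} {g : X → ℝ}
    {m : Measure X} : IsFlowEquilibrium φ g m ↔ IsFlowInvariantProb φ m ∧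
      flowPressure φ g ≤ entropy (φ 1) m + ((∫ x, g x ∂m : ℝ) : EReal) := by
  rw [IsFlowEquilibrium, flowPressure, iSup₂_le_iff]

namespace Suspension

variable {Z : Type*} [MeasurableSpace Z] {T : Z → Z} {l : Z → ℝ} {c C : ℝ}
  {f : Suspension T l → ℝ} {K : ℝ} {μ : Measure Z} [IsProbabilityMeasure μ]

theorem integral_liftMeasure (hlm : Measurable l) (hc : 0 < c) (hl : ∀ x, c ≤ l x)
    (hlC : ∀ x, l x ≤ C) (hf : Measurable f) (hf0 : ∀ z, 0 ≤ f z) (hfK : ∀ z, f z ≤ K) :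
    Integrable (baseFunction T l f) μ ∧
      ∫ z, f z ∂(liftMeasure T l μ) = (∫ x, baseFunction T l f x ∂μ) / ∫ x, l x ∂μ := by
  have hL : 0 < ∫ x, l x ∂μ := hc.trans_le (le_integral_roof hlm hl hlC)
  have hreg := measurableSet_region (l := l) hlm
  have hfm : Measurable fun p : Z × ℝ => f (mk T l p.1 p.2.toNNReal) :=
    hf.comp measurable_mk_toNNReal
  have hfin : (μ.prod volume) {p : Z × ℝ | 0 ≤ p.2 ∧ p.2 < l p.1} ≠ ∞ := by
    have hsub : {p : Z × ℝ | 0 ≤ p.2 ∧ p.2 < l p.1} ⊆ Set.univ ×ˢ Set.Ico 0 C := fun p hp =>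
      ⟨trivial, hp.1, hp.2.trans_le (hlC _)⟩
    refine ne_top_of_le_ne_top ?_ (measure_mono hsub)
    rw [Measure.prod_prod, Real.volume_Ico, measure_univ, one_mul]
    exact ENNReal.ofReal_ne_top
  have hint : IntegrableOn (fun p : Z × ℝ => f (mk T l p.1 p.2.toNNReal))
      {p : Z × ℝ | 0 ≤ p.2 ∧ p.2 < l p.1} (μ.prod volume) := by
    refine Measure.integrableOn_of_bounded (M := K) hfin hfm.aestronglyMeasurable
      (Eventually.of_forall fun p => ?_)
    rw [Real.norm_eq_abs, abs_of_nonneg (hf0 _)]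
    exact hfK _
  have hind := (integrable_indicator_iff hreg).2 hint
  have hslice : ∀ x, ∫ s, {p : Z × ℝ | 0 ≤ p.2 ∧ p.2 < l p.1}.indicator
      (fun p : Z × ℝ => f (mk T l p.1 p.2.toNNReal)) (x, s) = baseFunction T l f x := by
    intro x
    rw [baseFunction, intervalIntegral.integral_of_le (hc.le.trans (hl x)),
      ← integral_Ico_eq_integral_Ioc, ← integral_indicator measurableSet_Ico]
    rfl
  constructor
  · exact hind.integral_prod_left.congr (Eventually.of_forall hslice)
  · rw [liftMeasure, integral_smul_measure, integral_map measurable_mk_toNNReal.aemeasurable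
      hf.aestronglyMeasurable, ← integral_indicator hreg, integral_prod _ hind]
    simp only [hslice]
    rw [ENNReal.toReal_inv, ENNReal.toReal_ofReal hL.le, smul_eq_mul, div_eq_inv_mul]

/-- The free energies of a measure and its lift determine each other. -/
theorem free_energy_le_iff (hlm : Measurable l) (hc : 0 < c) (hl : ∀ x, c ≤ l x)
    (hlC : ∀ x, l x ≤ C) (hf : Measurable f) (hf0 : ∀ z, 0 ≤ f z) (hfK : ∀ z, f z ≤ K)
    (hTμ : MeasurePreserving T μ μ) (t d : ℝ) :
    entropy (flow T l 1) (liftMeasure T l μ) +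
        ((∫ z, f z ∂(liftMeasure T l μ) : ℝ) : EReal) ≤ (d : EReal) ↔
      entropy T μ + ((∫ x, (baseFunction T l f x - t * l x) ∂μ : ℝ) : EReal) ≤
        (((d - t) * ∫ x, l x ∂μ : ℝ) : EReal) := by
  have hL : 0 < ∫ x, l x ∂μ := hc.trans_le (le_integral_roof hlm hl hlC)
  obtain ⟨h1, h2⟩ := integral_liftMeasure (μ := μ) hlm hc hl hlC hf hf0 hfK
  rw [add_coe_le_coe_iff, add_coe_le_coe_iff, h2,
    integral_sub h1 ((integrable_roof hlm hl hlC).const_mul t), integral_const_mul,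
    ← entropy_flow_le_iff hlm hc hl hlC hTμ]
  have : d - (∫ x, baseFunction T l f x ∂μ) / ∫ x, l x ∂μ =
      ((d - t) * ∫ x, l x ∂μ -
        (∫ x, baseFunction T l f x ∂μ - t * ∫ x, l x ∂μ)) / ∫ x, l x ∂μ := by
    field_simp
    ring
  rw [this]

theorem flowPressure_le_iff (hT : Measurable T) (hlm : Measurable l) (hc : 0 < c)
    (hl : ∀ x, c ≤ l x) (hlC : ∀ x, l x ≤ C) {b : EReal} :
    flowPressure (flow T l) f ≤ b ↔ ∀ μ : Measure Z, IsInvariantProb T μ →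
      entropy (flow T l 1) (liftMeasure T l μ) +
        ((∫ z, f z ∂(liftMeasure T l μ) : ℝ) : EReal) ≤ b := by
  rw [flowPressure, iSup₂_le_iff]
  constructor
  · intro h μ hμ
    have := hμ.1
    exact h _ (isFlowInvariantProb_liftMeasure hlm hc hl hlC hμ.2)
  · intro h m hm
    obtain ⟨μ, hμ, rfl⟩ := exists_eq_liftMeasure hT hlm hc hl hlC hm
    exact h μ hμ

theorem flowPressure_eq_iff (hT : Measurable T) (hlm : Measurable l) (hc : 0 < c)
    (hl : ∀ x, c ≤ l x) (hlC : ∀ x, l x ≤ C) (hf : Measurable f) (hf0 : ∀ z, 0 ≤ f z)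
    (hfK : ∀ z, f z ≤ K) (hM : ∃ μ : Measure Z, IsInvariantProb T μ) (t : ℝ) :
    flowPressure (flow T l) f = t ↔
      pressure T (fun x => baseFunction T l f x - t * l x) = 0 := by
  have hC : 0 < C := by
    obtain ⟨μ, hμ⟩ := hM
    have := hμ.1
    obtain ⟨x⟩ := nonempty_of_isProbabilityMeasure μ
    exact hc.trans_le ((hl x).trans (hlC x))
  have e1 : flowPressure (flow T l) f ≤ t ↔
      pressure T (fun x => baseFunction T l f x - t * l x) ≤ ((0 : ℝ) : EReal) := by
    rw [flowPressure_le_iff hT hlm hc hl hlC, pressure, iSup₂_le_iff]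
    refine forall₂_congr fun μ hμ => ?_
    have := hμ.1
    rw [free_energy_le_iff hlm hc hl hlC hf hf0 hfK hμ.2 t, sub_self, zero_mul]
  have e2 : (t : EReal) ≤ flowPressure (flow T l) f ↔
      ((0 : ℝ) : EReal) ≤ pressure T (fun x => baseFunction T l f x - t * l x) := by
    rw [coe_le_iff_forall_lt, coe_le_iff_forall_lt]
    constructor
    · intro h e he hP
      -- As `e < 0` and `∫ l dμ ≤ C`, one has `e ≤ (e / C) * ∫ l dμ` for every `μ`; the converse
      -- uses `c ≤ ∫ l dμ` in the same way.
      refine h (t + e / C) (by linarith [div_neg_of_neg_of_pos he hC]) ?_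
      rw [flowPressure_le_iff hT hlm hc hl hlC]
      rw [pressure, iSup₂_le_iff] at hP
      intro μ hμ
      have := hμ.1
      rw [free_energy_le_iff hlm hc hl hlC hf hf0 hfK hμ.2 t]
      refine (hP μ hμ).trans (EReal.coe_le_coe_iff.2 ?_)
      have h1 := integral_roof_le (μ := μ) hlm hl hlC
      have h2 := mul_le_mul_of_nonpos_left h1 (div_neg_of_neg_of_pos he hC).le
      rw [div_mul_cancel₀ _ hC.ne'] at h2
      linarith
    · intro h d hd hP
      refine h ((d - t) * c) (mul_neg_of_neg_of_pos (by linarith) hc) ?_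
      rw [flowPressure_le_iff hT hlm hc hl hlC] at hP
      rw [pressure, iSup₂_le_iff]
      intro μ hμ
      have := hμ.1
      have h0 := hP μ hμ
      rw [free_energy_le_iff hlm hc hl hlC hf hf0 hfK hμ.2 t] at h0
      refine h0.trans (EReal.coe_le_coe_iff.2 ?_)
      exact mul_le_mul_of_nonpos_left (le_integral_roof hlm hl hlC) (by linarith)
  rw [le_antisymm_iff, e1, e2, ← le_antisymm_iff, EReal.coe_zero]

theorem exists_flowPressure_eq_coe (hT : Measurable T) (hlm : Measurable l) (hc : 0 < c)
    (hl : ∀ x, c ≤ l x) (hlC : ∀ x, l x ≤ C) (hf0 : ∀ z, 0 ≤ f z)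
    (hfK : ∀ z, f z ≤ K) (hM : ∃ μ : Measure Z, IsInvariantProb T μ)
    (hH : ∃ H : ℝ, ∀ μ : Measure Z, IsInvariantProb T μ → entropy T μ ≤ H) :
    ∃ t : ℝ, flowPressure (flow T l) f = t := by
  obtain ⟨H, hH⟩ := hH
  -- Replacing `H` by `max H 0` makes the Abramov quotient largest at the smallest denominator `c`.
  have hle : flowPressure (flow T l) f ≤ ((max H 0 / c + |K| : ℝ) : EReal) := by
    rw [flowPressure_le_iff hT hlm hc hl hlC]
    intro μ hμ
    have := hμ.1
    have := isProbabilityMeasure_liftMeasure (T := T) (μ := μ) hlm hc hl hlC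
    have h1 := le_integral_roof (μ := μ) hlm hl hlC
    have h2 := (entropy_flow_le_iff hlm hc hl hlC hμ.2 (max H 0)).2
      ((hH μ hμ).trans (EReal.coe_le_coe_iff.2 (le_max_left _ _)))
    have h3 : max H 0 / ∫ x, l x ∂μ ≤ max H 0 / c :=
      div_le_div_of_nonneg_left (le_max_right _ _) hc h1
    have h4 : ∫ z, f z ∂(liftMeasure T l μ) ≤ |K| := by
      refine (integral_mono_of_nonneg (Eventually.of_forall hf0) (integrable_const |K|)
        (Eventually.of_forall fun z => (hfK z).trans (le_abs_self K))).trans_eq ?_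
      simp
    rw [EReal.coe_add]
    exact add_le_add (h2.trans (EReal.coe_le_coe_iff.2 h3)) (EReal.coe_le_coe_iff.2 h4)
  have hge : (0 : EReal) ≤ flowPressure (flow T l) f := by
    obtain ⟨μ, hμ⟩ := hM
    have := hμ.1
    have hinv := isFlowInvariantProb_liftMeasure (T := T) hlm hc hl hlC hμ.2
    have := hinv.1
    refine le_trans ?_ (le_iSup₂ (f := fun m (_ : IsFlowInvariantProb (flow T l) m) =>
      entropy (flow T l 1) m + ((∫ x, f x ∂m : ℝ) : EReal)) _ hinv)
    exact add_nonneg (entropy_nonneg (hinv.2 1)) (EReal.coe_nonneg.2 (integral_nonneg hf0))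
  refine ⟨(flowPressure (flow T l) f).toReal, (EReal.coe_toReal ?_ ?_).symm⟩
  · exact ne_top_of_le_ne_top (EReal.coe_ne_top _) hle
  · exact ne_bot_of_le_ne_bot (by simp) hge

/-- A deficit `e < 0` of `μ` corresponds to the deficit `e / ∫ l dμ` of its lift, so both are zero
together. Invariance of `μ` follows from that of the lift. -/
theorem isEquilibrium_iff_isFlowEquilibrium (hT : Measurable T) (hlm : Measurable l) (hc : 0 < c)
    (hl : ∀ x, c ≤ l x) (hlC : ∀ x, l x ≤ C) (hf : Measurable f) (hf0 : ∀ z, 0 ≤ f z)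
    (hfK : ∀ z, f z ≤ K) {t : ℝ} (hflow : flowPressure (flow T l) f = t)
    (hbase : pressure T (fun x => baseFunction T l f x - t * l x) = 0) :
    IsEquilibrium T (fun x => baseFunction T l f x - t * l x) μ ↔
      IsFlowEquilibrium (flow T l) f (liftMeasure T l μ) := by
  have hL : 0 < ∫ x, l x ∂μ := hc.trans_le (le_integral_roof hlm hl hlC)
  rw [isEquilibrium_iff, isFlowEquilibrium_iff, hflow, hbase, ← EReal.coe_zero,
    coe_le_iff_forall_lt, coe_le_iff_forall_lt]
  constructor
  · rintro ⟨hμ, h⟩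
    refine ⟨isFlowInvariantProb_liftMeasure hlm hc hl hlC hμ.2, fun d hd h' => ?_⟩
    rw [free_energy_le_iff hlm hc hl hlC hf hf0 hfK hμ.2 t] at h'
    exact h _ (mul_neg_of_neg_of_pos (by linarith) hL) h'
  · rintro ⟨hm, h⟩
    have hμ := measurePreserving_of_liftMeasure hT hlm hc hl hlC hm
    refine ⟨⟨inferInstance, hμ⟩, fun e he h' => ?_⟩
    refine h (t + e / ∫ x, l x ∂μ) (by linarith [div_neg_of_neg_of_pos he hL]) ?_
    rw [free_energy_le_iff hlm hc hl hlC hf hf0 hfK hμ t, add_sub_cancel_left,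
      div_mul_cancel₀ _ hL.ne']
    exact h'

end Suspension

end SuspensionPressure

/-! ### Assembly of the theorem -/

theorem proposition2p1 {Z : Type*} [MeasurableSpace Z] (T : Z → Z) (hT : Measurable T)
    (hM : ∃ μ : Measure Z, SuspensionPressure.IsInvariantProb T μ)
    (l : Z → ℝ) (hl : Measurable l)
    (hl_bdd : ∃ c C : ℝ, 0 < c ∧ ∀ x, c ≤ l x ∧ l x ≤ C)
    (f : SuspensionPressure.Suspension T l → ℝ) (hf : Measurable f)
    (hf_nonneg : ∀ z, 0 ≤ f z) (hf_bdd : ∃ K : ℝ, ∀ z, f z ≤ K) :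
    -- for real `t`, the pressure of `f` equals `t` iff the pressure of `f_Z - t l` vanishes
    (∀ t : ℝ, SuspensionPressure.flowPressure (SuspensionPressure.Suspension.flow T l) f = t ↔
      SuspensionPressure.pressure T
        (fun x => SuspensionPressure.Suspension.baseFunction T l f x - t * l x) = 0) ∧
    -- there is exactly one such `t` if the entropies of the `T`-invariant measures are bounded
    ((∃ H : ℝ, ∀ μ : Measure Z, SuspensionPressure.IsInvariantProb T μ →
        SuspensionPressure.entropy T μ ≤ H) →
      ∃! t₀ : ℝ, SuspensionPressure.pressure T
        (fun x => SuspensionPressure.Suspension.baseFunction T l f x - t₀ * l x) = 0) ∧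
    -- equilibrium measures correspond to each other
    (∀ t₀ : ℝ, SuspensionPressure.pressure T
        (fun x => SuspensionPressure.Suspension.baseFunction T l f x - t₀ * l x) = 0 →
      ∀ μ : Measure Z, IsProbabilityMeasure μ →
        (SuspensionPressure.IsEquilibrium T
            (fun x => SuspensionPressure.Suspension.baseFunction T l f x - t₀ * l x) μ ↔
          SuspensionPressure.IsFlowEquilibrium (SuspensionPressure.Suspension.flow T l) f
            (SuspensionPressure.Suspension.liftMeasure T l μ))) := by
  obtain ⟨c, C, hc, hlC'⟩ := hl_bdd
  obtain ⟨K, hfK⟩ := hf_bdd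
  have hlc := fun x => (hlC' x).1
  have hlC := fun x => (hlC' x).2
  have hiff := SuspensionPressure.Suspension.flowPressure_eq_iff (f := f) hT hl hc hlc hlC hf
    hf_nonneg hfK hM
  refine ⟨hiff, fun hH => ?_, fun t₀ ht₀ μ hμ => ?_⟩
  · obtain ⟨t, ht⟩ := SuspensionPressure.Suspension.exists_flowPressure_eq_coe (f := f) hT hl hc hlc
      hlC hf_nonneg hfK hM hH
    refine ⟨t, (hiff t).1 ht, fun t' ht' => ?_⟩
    -- Every zero of the base pressure equals the single number `flowPressure`.
    exact EReal.coe_eq_coe_iff.1 (((hiff t').2 ht').symm.trans ht)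
  · exact SuspensionPressure.Suspension.isEquilibrium_iff_isFlowEquilibrium hT hl hc hlc hlC hf
      hf_nonneg hfK ((hiff t₀).2 ht₀) ht₀
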